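/- Let $m\in\mathbb N$ and $X=\{x_0,x_1,\dots,x_m\}$. Call $x_0$ white and the other letters black. **Decorated rooted circle trees.** A decorated rooted circle tree (rct) $c^i$ has a root with index $i\in\{1,\dots,m\}$ and finitely many internal vertices, linearly ordered clockwise from the root, each decorated by a letter of $X$; rcts are taken up to isomorphism, so $c^i$ is given by $i$ and the word $\eta\in X^*$ of its decorations. A nonempty set $J$ of internal vertices is *admissible* if its minimal element is white. An *admissible extraction* $\mathcal J=\{J_1,\dots,J_k\}$ ($k\ge 0$) is a set of pairwise disjoint admissible subsets. For $n_1,\dots,n_k\in\{1,\dots,m\}$ let $c^i_{n_1\cdots n_k}$ be the rct obtained from $c^i$ by redecorating the minimal element of each $J_l$ by $x_{n_l}$ and deleting the other elements of $J_l$, and let $c^{n_l}_{|J_l}$ be the rct with root index $n_l$ whose internal vertices are the non-minimal elements of $J_l$ with their order and decorations. Let $\mathcal C_X^\circ$ be the real linear span of the rcts and $\mathcal H_X^\circ$ the real polynomial algebra generated by them, with the algebra homomorphism $\Delta$ given on rcts by $$\Delta(c^i)=\tilde\Delta(c^i)+\mathbf 1\otimes c^i,\qquad \tilde\Delta(c^i)=\sum_{\mathcal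 J}\ \sum_{n_1,\dots,n_k=1}^m c^i_{n_1\cdots n_k}\otimes c^{n_1}_{|J_1}\cdots c^{n_k}_{|J_k},$$ and with the counit that kills all rcts. Put $\deg c^i=2\cdot\#\{\text{white internal vertices}\}+\#\{\text{black internal vertices}\}+1$. **The Hopf algebra $H$.** For $c,d\in\mathbb R^m\langle\langle X\rangle\rangle$ let $c\,\tilde\circ\,d=\sum_{\eta}(c,\eta)\,\phi_d(\eta)(1)$ (componentwise in $c$), where $\phi_d(\emptyset)=\mathrm{id}$, $\phi_d(x_k\eta)=\phi_d(x_k)\circ\phi_d(\eta)$, $\phi_d(x_k)(e)=x_ke+x_0(d_k \sqcup\!\sqcup\, e)$ with $d_0=0$ and $\sqcup\!\sqcup$ the shuffle product, and let $c\circledcirc d=d+c\,\tilde\circ\,d$; this is the product of the output feedback group, $(\delta+c)\circ(\delta+d)=\delta+c\circledcirc d$. For $1\le i\le m$ and $\eta\in X^*$ let $a^i_\eta(c)=(c_i,\eta)$ be the coordinate map, let $V^+$ be the real span of these maps, and let $H$ be the free commutative real algebra on them, with $\deg a^i_\eta=2|\eta|_{x_0}+\sum_{j=1}^m|\eta|_{x_j}+1$.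 Put $\theta_k a^i_\eta=a^i_{x_k\eta}$, and let $\Delta^j_{\sqcup\!\sqcup}:V^+\to V^+\otimes V^+$ and $\tilde\Delta:V^+\to V^+\otimes H$ be the linear maps determined by the following recursions, where $1\le i,j\le m$, $0\le k\le m$ and $\mu$ is the multiplication: $$\Delta^j_{\sqcup\!\sqcup}a^i_\emptyset=a^i_\emptyset\otimes a^j_\emptyset,\qquad \Delta^j_{\sqcup\!\sqcup}\theta_k=(\theta_k\otimes\mathrm{id}+\mathrm{id}\otimes\theta_k)\Delta^j_{\sqcup\!\sqcup},$$ $$\tilde\Delta a^i_\emptyset=a^i_\emptyset\otimes\mathbf 1,\quad \tilde\Delta\theta_i=(\theta_i\otimes\mathrm{id})\tilde\Delta,\quad \tilde\Delta\theta_0=(\theta_0\otimes\mathrm{id})\tilde\Delta+\sum_{n=1}^m(\theta_n\otimes\mu)(\tilde\Delta\otimes\mathrm{id})\Delta^n_{\sqcup\!\sqcup}.$$ The coproduct of $H$ is the algebra homomorphism with $\Delta a^i_\eta=\tilde\Delta a^i_\eta+\mathbf 1\otimes a^i_\eta$, and its counit kills all $a^i_\eta$. **Theorem.** $\mathcal H_X^\circ$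 and $H$ are Hopf algebras; the coproduct of $H$ is the one induced by the group product, i.e. $(\Delta f)(c,d)=f(c\circledcirc d)$ for all $f\in H$ and $c,d\in\mathbb R^m\langle\langle X\rangle\rangle$, where $(f\otimes g)(c,d)=f(c)g(d)$; and there is an isomorphism of graded Hopf algebras $\varphi:\mathcal H_X^\circ\to H$ (compatible with products, units, coproducts, counits, antipodes and degrees) with $\varphi(c^i)=a^i_\eta$ for every rct $c^i$ with word of decorations $\eta$. Moreover, the map $\tilde\Delta$ of rcts satisfies the same recursions as that of $H$, with $a^i_\emptyset$ replaced by the rct with root $i$ and no internal vertices, $\theta_k$ by the operator on $\mathcal C_X^\circ$ that inserts a vertex decorated by $x_k$ directly after the root, and $\Delta^j_{\sqcup\!\sqcup}$ by $c^i\mapsto\sum_J (c^i/J)\otimes c^j_{J}$, where $J$ runs over all sets of internal vertices of $c^i$, $c^i/J$ is $c^i$ with the vertices in $J$ deleted, and $c^j_{J}$ is the rct with root index $j$ and internal vertices $J$. -/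

import Mathlib

open scoped TensorProduct

namespace RctHopf

noncomputable section

/-! ## Hopf algebras given by explicit structure maps -/

/-- The algebra `A` with the comultiplication and counit carried by its `CoalgebraStruct` is a
Hopf algebra with antipode `S`: the coalgebra axioms, multiplicativity and unitality of both
structure maps, and the two antipode axioms. -/
structure IsHopfAlgebra (A : Type*) [CommRing A] [Algebra ℝ A] [CoalgebraStruct ℝ A]
    (S : A →ₗ[ℝ] A) : Prop where
  coassoc : TensorProduct.assoc ℝ A A A ∘ₗ
      (CoalgebraStruct.comul (R := ℝ) (A := A)).rTensor A ∘ₗ CoalgebraStruct.comul =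
    (CoalgebraStruct.comul (R := ℝ) (A := A)).lTensor A ∘ₗ CoalgebraStruct.comul
  rTensor_counit_comp_comul :
    (CoalgebraStruct.counit (R := ℝ) (A := A)).rTensor A ∘ₗ CoalgebraStruct.comul =
      TensorProduct.mk ℝ ℝ A 1
  lTensor_counit_comp_comul :
    (CoalgebraStruct.counit (R := ℝ) (A := A)).lTensor A ∘ₗ CoalgebraStruct.comul =
      (TensorProduct.mk ℝ A ℝ).flip 1
  counit_one : CoalgebraStruct.counit (R := ℝ) (1 : A) = 1
  counit_mul : ∀ a b : A, CoalgebraStruct.counit (R := ℝ) (a * b) =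
    CoalgebraStruct.counit (R := ℝ) a * CoalgebraStruct.counit (R := ℝ) b
  comul_one : CoalgebraStruct.comul (R := ℝ) (1 : A) = 1
  comul_mul : ∀ a b : A, CoalgebraStruct.comul (R := ℝ) (a * b) =
    CoalgebraStruct.comul (R := ℝ) a * CoalgebraStruct.comul (R := ℝ) b
  antipode_left : LinearMap.mul' ℝ A ∘ₗ S.rTensor A ∘ₗ CoalgebraStruct.comul =
    Algebra.linearMap ℝ A ∘ₗ CoalgebraStruct.counit
  antipode_right : LinearMap.mul' ℝ A ∘ₗ S.lTensor A ∘ₗ CoalgebraStruct.comul =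
    Algebra.linearMap ℝ A ∘ₗ CoalgebraStruct.counit

/-- The predicate `IsHopfAlgebra` provides Mathlib's `HopfAlgebra` structure, with the given
comultiplication, counit and antipode. -/
abbrev IsHopfAlgebra.toHopfAlgebra {A : Type*} [CommRing A] [alg : Algebra ℝ A]
    [str : CoalgebraStruct ℝ A] {S : A →ₗ[ℝ] A} (h : IsHopfAlgebra A S) : HopfAlgebra ℝ A :=
  letI : Coalgebra ℝ A :=
    { str with
      coassoc := h.coassoc
      rTensor_counit_comp_comul := h.rTensor_counit_comp_comul
      lTensor_counit_comp_comul := h.lTensor_counit_comp_comul }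
  { Bialgebra.mk' ℝ A h.counit_one (fun {a b} => h.counit_mul a b)
      h.comul_one (fun {a b} => h.comul_mul a b) with
    antipode := S
    mul_antipode_rTensor_comul := h.antipode_left
    mul_antipode_lTensor_comul := h.antipode_right }

/-! ## Words over the alphabet `X = {x₀, …, x_m}`

The letter `x_k` is `k : Fin (m + 1)`. A root or channel index `i ∈ {1, …, m}` is an element of
`Fin m`, and the letter `x_i` with the same index is `i.succ`. -/

abbrev Word (m : ℕ) := List (Fin (m + 1))

/-- All ways (with multiplicity) of distributing the positions of a word over two complementary
subwords. -/
def deshuffle {X : Type*} : List X → List (List X × List X)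
  | [] => [([], [])]
  | k :: w => (deshuffle w).map (fun p => (k :: p.1, p.2)) ++
      (deshuffle w).map (fun p => (p.1, k :: p.2))

theorem deshuffle_length_le {X : Type*} (w : List X) :
    ∀ p ∈ deshuffle w, p.1.length ≤ w.length := by
  induction w with
  | nil => intro p hp; simp [deshuffle] at hp; simp [hp]
  | cons k w ih =>
    intro p hp
    simp only [deshuffle, List.mem_append, List.mem_map] at hp
    rcases hp with ⟨q, hq, rfl⟩ | ⟨q, hq, rfl⟩
    · simpa using ih q hq
    · exact (ih q hq).trans (by simp)

/-- The inclusion of the span of the generators into the polynomial algebra. -/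
def incl (σ : Type*) : (σ →₀ ℝ) →ₗ[ℝ] MvPolynomial σ ℝ :=
  Finsupp.linearCombination ℝ MvPolynomial.X

/-! ## Decorated rooted circle trees -/

/-- A decorated rooted circle tree: the index of its root and the decorations of its internal
vertices `0, …, size - 1`, listed clockwise from the root. -/
structure Rct (m : ℕ) where
  root : Fin m
  size : ℕ
  dec : Fin size → Fin (m + 1)

namespace Rct

variable {m : ℕ}

/-- The word of vertex decorations. -/
def word (c : Rct m) : Word m := List.ofFn c.dec

/-- Vertices decorated by `x₀` (white) count twice. -/
def degree (c : Rct m) : ℕ := (∑ v, if c.dec v = 0 then 2 else 1) + 1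

/-- The tree without internal vertices. -/
def bare (i : Fin m) : Rct m := ⟨i, 0, Fin.elim0⟩

/-- Insert a vertex decorated by `x_k` directly after the root. -/
def insert (k : Fin (m + 1)) (c : Rct m) : Rct m := ⟨c.root, c.size + 1, Fin.cons k c.dec⟩

/-- The tree with root `i` whose internal vertices are those of `c` that lie in `s`, in the order
of `c`, decorated through `d`. -/
def restrict (c : Rct m) (i : Fin m) (s : Finset (Fin c.size)) (d : Fin c.size → Fin (m + 1)) :
    Rct m := ⟨i, s.card, fun j => d (s.orderEmbOfFin rfl j)⟩

/-- A (nonempty) set of internal vertices is admissible if its minimal element is white. -/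
def IsAdmissible (c : Rct m) (J : Finset (Fin c.size)) : Prop :=
  ∃ v, IsLeast (J : Set (Fin c.size)) v ∧ c.dec v = 0

open Classical in
/-- The admissible extractions: the sets of pairwise disjoint admissible subsets. -/
def extractions (c : Rct m) : Finset (Finset (Finset (Fin c.size))) :=
  Finset.univ.filter fun E =>
    (∀ J ∈ E, c.IsAdmissible J) ∧ (E : Set (Finset (Fin c.size))).PairwiseDisjoint id

open Classical in
/-- The elements of `J` other than its minimal element. -/
def tail (c : Rct m) (J : Finset (Fin c.size)) : Finset (Fin c.size) :=
  J.filter fun v => ¬ IsLeast (J : Set (Fin c.size)) v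

/-- The tree extracted along `J`: the minimal element of `J` becomes the root, with index `n`, and
the other elements of `J` are the internal vertices. -/
def sub (c : Rct m) (J : Finset (Fin c.size)) (n : Fin m) : Rct m :=
  c.restrict n (c.tail J) c.dec

open Classical in
/-- The tree left after the extraction `E`: the minimal element of each `J ∈ E` is redecorated by
`x_{n J}`, and the other elements of `J` are removed. -/
def quot (c : Rct m) (E : Finset (Finset (Fin c.size))) (n : E → Fin m) : Rct m :=
  c.restrict c.root (Finset.univ.filter fun v => ∀ J ∈ E, v ∉ c.tail J) fun v =>
    if h : ∃ J : E, IsLeast ((J : Finset (Fin c.size)) : Set (Fin c.size)) v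
    then (n h.choose).succ else c.dec v

end Rct

/-- The linear span of the decorated rooted circle trees. -/
abbrev RctSpan (m : ℕ) := Rct m →₀ ℝ

/-- The polynomial algebra on the decorated rooted circle trees. -/
abbrev RctAlgebra (m : ℕ) := MvPolynomial (Rct m) ℝ

variable {m : ℕ}

/-- The operator that inserts a vertex decorated by `x_k` directly after the root. -/
def rctTheta (k : Fin (m + 1)) : RctSpan m →ₗ[ℝ] RctSpan m :=
  Finsupp.lmapDomain ℝ ℝ (Rct.insert k)

/-- The deshuffling of trees: the sum over all sets `J` of internal vertices of `c` of
`(c / J) ⊗ c_J`, where `c_J` has root `j`. -/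
def rctDeshuffle (j : Fin m) : RctSpan m →ₗ[ℝ] RctSpan m ⊗[ℝ] RctSpan m :=
  Finsupp.linearCombination ℝ fun c : Rct m =>
    ∑ J : Finset (Fin c.size), Finsupp.single (c.restrict c.root Jᶜ c.dec) (1 : ℝ) ⊗ₜ[ℝ]
      Finsupp.single (c.restrict j J c.dec) (1 : ℝ)

/-- The sum over the admissible extractions of a tree and over all indices `1, …, m` for the roots
of the extracted trees. -/
def rctTilde : RctSpan m →ₗ[ℝ] RctSpan m ⊗[ℝ] RctAlgebra m :=
  Finsupp.linearCombination ℝ fun c : Rct m =>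
    ∑ E ∈ c.extractions, ∑ n : E → Fin m,
      Finsupp.single (c.quot E n) (1 : ℝ) ⊗ₜ[ℝ]
        ∏ J : E, (MvPolynomial.X (c.sub J (n J)) : RctAlgebra m)

/-- The coproduct of trees on the generators, `Δ c = ∑ quot ⊗ ∏ sub + 1 ⊗ c` (the last term being
the extraction of the full tree), extended multiplicatively; the counit kills all trees. -/
instance rctCoalgebraStruct : CoalgebraStruct ℝ (RctAlgebra m) where
  comul := (MvPolynomial.aeval fun c : Rct m =>
    TensorProduct.map (incl (Rct m)) LinearMap.id (rctTilde (Finsupp.single c (1 : ℝ))) +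
      (1 : RctAlgebra m) ⊗ₜ[ℝ] (MvPolynomial.X c : RctAlgebra m) :
    RctAlgebra m →ₐ[ℝ] RctAlgebra m ⊗[ℝ] RctAlgebra m).toLinearMap
  counit := (MvPolynomial.aeval fun _ : Rct m => (0 : ℝ)).toLinearMap

/-! ## Formal power series and the output feedback group -/

/-- Real formal power series in the noncommuting letters of `X`; `c η` is the coefficient of
the word `η`. -/
abbrev Series (m : ℕ) := Word m → ℝ

/-- The series `1`, that is, the empty word. -/
def oneSeries : Series m := fun w => if w = [] then 1 else 0

/-- Catenation with the letter `x_k` on the left. -/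
def leftMul (k : Fin (m + 1)) (e : Series m) : Series m
  | [] => 0
  | j :: w => if j = k then e w else 0

/-- The shuffle product: the coefficient of `η` is the sum of `c(u) d(v)` over all ways to write
`η` as a shuffle of `u` and `v`. -/
def shuffle (c d : Series m) : Series m :=
  fun w => ((deshuffle w).map fun p => c p.1 * d p.2).sum

/-- `e ↦ x_k e + x₀ (d_k ⧢ e)`, with `d₀ = 0`. -/
def modStep (d : Fin m → Series m) (k : Fin (m + 1)) (e : Series m) : Series m :=
  leftMul k e + leftMul 0 (shuffle ((Fin.cons 0 d : Fin (m + 1) → Series m) k) e)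

/-- The composite of the maps `modStep d k` along the letters of a word. -/
def modWord (d : Fin m → Series m) : Word m → Series m → Series m
  | [], e => e
  | k :: w, e => modStep d k (modWord d w e)

/-- The modified composition product `∑_ξ (c, ξ) φ_d(ξ)(1)` of a series `c` with `d`. For each
word `η` only the finitely many `ξ` of length at most that of `η` contribute. -/
def modComp (c : Series m) (d : Fin m → Series m) : Series m :=
  fun w => ∑ᶠ v : Word m, c v * modWord d v oneSeries w

/-- The product of the output feedback group, `(δ + c) ∘ (δ + d) = δ + feedbackProd c d`. -/
def feedbackProd (c d : Fin m → Series m) : Fin m → Series m :=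
  fun i => d i + modComp (c i) d

/-! ## The Faà di Bruno type Hopf algebra of coordinate maps -/

/-- The labels of the coordinate maps `a^i_η`. -/
structure Coord (m : ℕ) where
  idx : Fin m
  word : Word m

namespace Coord

/-- The coordinate map `a^i_η : c ↦ (c_i, η)`. -/
def toFun (a : Coord m) (c : Fin m → Series m) : ℝ := c a.idx a.word

/-- `2 |η|_{x₀} + ∑ j, |η|_{x_j} + 1`. -/
def degree (a : Coord m) : ℕ := 2 * a.word.count 0 + ∑ j : Fin m, a.word.count j.succ + 1

end Coord

/-- The span of the coordinate maps. -/
abbrev CoordSpan (m : ℕ) := Coord m →₀ ℝ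

/-- The free commutative algebra on the coordinate maps. -/
abbrev CoordAlgebra (m : ℕ) := MvPolynomial (Coord m) ℝ

/-- The value of a polynomial in the coordinate maps at `c`. -/
def evalAt (c : Fin m → Series m) : CoordAlgebra m →ₐ[ℝ] ℝ :=
  MvPolynomial.aeval fun a : Coord m => a.toFun c

/-- The value of an element of `H ⊗ H` at a pair, `(f ⊗ g)(c, d) = f(c) g(d)`. -/
def evalAtPair (c d : Fin m → Series m) : CoordAlgebra m ⊗[ℝ] CoordAlgebra m →ₐ[ℝ] ℝ :=
  Algebra.TensorProduct.productMap (evalAt c) (evalAt d)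

/-- `θ_k a^i_η = a^i_{x_k η}`. -/
def theta (k : Fin (m + 1)) : CoordSpan m →ₗ[ℝ] CoordSpan m :=
  Finsupp.lmapDomain ℝ ℝ fun a => ⟨a.idx, k :: a.word⟩

/-- The deshuffle coproduct `Δ^j a^i_η = ∑ a^i_u ⊗ a^j_v`. -/
def coordDeshuffle (j : Fin m) : CoordSpan m →ₗ[ℝ] CoordSpan m ⊗[ℝ] CoordSpan m :=
  Finsupp.linearCombination ℝ fun a : Coord m => ((deshuffle a.word).map fun p =>
    Finsupp.single (⟨a.idx, p.1⟩ : Coord m) (1 : ℝ) ⊗ₜ[ℝ]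
      Finsupp.single (⟨j, p.2⟩ : Coord m) (1 : ℝ)).sum

/-- The value of the coproduct `Δ̃` on `a^i_η`, by recursion on `η`:
`Δ̃ a^i_∅ = a^i_∅ ⊗ 1`, `Δ̃ θ_k = (θ_k ⊗ id) Δ̃` for `k ≠ 0`, and
`Δ̃ θ₀ = (θ₀ ⊗ id) Δ̃ + ∑_n (θ_n ⊗ μ) (Δ̃ ⊗ id) Δ^n`, with `Δ^n` the deshuffle coproduct. -/
def tildeWord (i : Fin m) : Word m → CoordSpan m ⊗[ℝ] CoordAlgebra m
  | [] => Finsupp.single (⟨i, []⟩ : Coord m) (1 : ℝ) ⊗ₜ[ℝ] 1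
  | k :: w =>
    TensorProduct.map (theta k) LinearMap.id (tildeWord i w) +
      if k = 0 then
        ∑ n : Fin m, ((deshuffle w).attach.map fun p =>
          TensorProduct.map (theta n.succ)
            (LinearMap.mulRight ℝ (MvPolynomial.X ⟨n, p.1.2⟩ : CoordAlgebra m))
            (tildeWord i p.1.1)).sum
      else 0
termination_by w => w.length
decreasing_by
  · simp
  · exact Nat.lt_succ_of_le (deshuffle_length_le w p.1 p.2)

/-- The coproduct `Δ̃`. -/
def coordTilde : CoordSpan m →ₗ[ℝ] CoordSpan m ⊗[ℝ] CoordAlgebra m :=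
  Finsupp.linearCombination ℝ fun a : Coord m => tildeWord a.idx a.word

/-- The coproduct `Δ a = Δ̃ a + 1 ⊗ a` on the coordinate maps, extended multiplicatively; the counit
kills all coordinate maps. -/
instance coordCoalgebraStruct : CoalgebraStruct ℝ (CoordAlgebra m) where
  comul := (MvPolynomial.aeval fun a : Coord m =>
    TensorProduct.map (incl (Coord m)) LinearMap.id (coordTilde (Finsupp.single a (1 : ℝ))) +
      (1 : CoordAlgebra m) ⊗ₜ[ℝ] (MvPolynomial.X a : CoordAlgebra m) :
    CoordAlgebra m →ₐ[ℝ] CoordAlgebra m ⊗[ℝ] CoordAlgebra m).toLinearMap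
  counit := (MvPolynomial.aeval fun _ : Coord m => (0 : ℝ)).toLinearMap

/-! ## The recursions -/

/-- The recursions for a deshuffle coproduct `dsh` and a coproduct `tilde` in terms of operators
`θ_0, …, θ_m`, starting from the elements `e i`, `1 ≤ i ≤ m`. -/
structure SatisfiesRecursions {σ : Type*} (e : Fin m → σ)
    (θ : Fin (m + 1) → (σ →₀ ℝ) →ₗ[ℝ] (σ →₀ ℝ))
    (dsh : Fin m → (σ →₀ ℝ) →ₗ[ℝ] (σ →₀ ℝ) ⊗[ℝ] (σ →₀ ℝ))
    (tilde : (σ →₀ ℝ) →ₗ[ℝ] (σ →₀ ℝ) ⊗[ℝ] MvPolynomial σ ℝ) : Prop where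
  dsh_empty : ∀ i j, dsh j (Finsupp.single (e i) 1) =
    Finsupp.single (e i) (1 : ℝ) ⊗ₜ[ℝ] Finsupp.single (e j) (1 : ℝ)
  dsh_theta : ∀ j k, dsh j ∘ₗ θ k =
    (TensorProduct.map (θ k) LinearMap.id + TensorProduct.map LinearMap.id (θ k)) ∘ₗ dsh j
  tilde_empty : ∀ i, tilde (Finsupp.single (e i) 1) = Finsupp.single (e i) (1 : ℝ) ⊗ₜ[ℝ] 1
  tilde_theta : ∀ i : Fin m, tilde ∘ₗ θ i.succ =
    TensorProduct.map (θ i.succ) LinearMap.id ∘ₗ tilde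
  tilde_theta_zero : tilde ∘ₗ θ 0 = TensorProduct.map (θ 0) LinearMap.id ∘ₗ tilde +
    ∑ n : Fin m,
      TensorProduct.map (θ n.succ)
          (LinearMap.mul' ℝ (MvPolynomial σ ℝ) ∘ₗ (incl σ).lTensor (MvPolynomial σ ℝ)) ∘ₗ
        (TensorProduct.assoc ℝ (σ →₀ ℝ) (MvPolynomial σ ℝ) (σ →₀ ℝ)).toLinearMap ∘ₗ
        tilde.rTensor (σ →₀ ℝ) ∘ₗ dsh n

end

end RctHopf

/-!
The Hopf algebra `H` of coordinate maps is handled through its points. For a commutative real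
algebra `A`, an algebra homomorphism `H → A` is a tuple of series with coefficients in `A`
(`point`), and by its recursion the coproduct of `H` turns pairs of such homomorphisms into the
product `c ⊚ d = d + c ∘ d` of series over `A` (`point_comp_coordComul`). Hence coassociativity, the
counit axioms and the antipode axioms of `H` are the statements that the tuples of series over `A`
form a group, applied to universal points; the case `A = ℝ` is the claim that the coproduct is
induced by the product of the output feedback group. The infinite sum in the definition of the
modified composition product is identified with the recursive form `Ser.comp` in
`modComp_eq_comp`.

The group axioms are proved over any commutative ring. The left derivatives `x_k⁻¹` are derivations
of the shuffle algebra, and `Ser.comp` is defined by its behaviour under them. Comparing left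
derivatives, by induction on the length of words, gives `(c ⧢ c') ∘ d = (c ∘ d) ⧢ (c' ∘ d)`
(`Ser.mul_comp`) and `(c ∘ d) ∘ e = c ∘ (d ⊚ e)` (`Ser.comp_comp`), from which associativity
follows. The map `d ↦ -(c ∘ d)` is contracting for the length of words, and its fixed point is a
right inverse of `c`; in a monoid in which every element has a right inverse these are two-sided.

On the side of trees, the sum over the admissible extractions of a tree is compared with the
recursion for words by looking at the first vertex `a` (`sum_decoratedExtractions_insert`). Either
`a` belongs to no extracted subset, or `a` is white and the subset containing it is `{a} ∪ J` for an
arbitrary set `J` of later vertices, and the other extracted subsets form an extraction of the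
complement of `J`. The sum over `J` is the deshuffle coproduct. So the bijection of trees with
coordinate maps intertwines the two coproducts `Δ̃` (`map_rctTilde`), and the Hopf algebra axioms and
the recursions are transported along it.
-/

namespace RctHopf

noncomputable section

/-! ### The shuffle algebra -/

theorem deshuffle_length_add {X : Type*} (w : List X) :
    ∀ p ∈ deshuffle w, p.1.length + p.2.length = w.length := by
  induction w with
  | nil => intro p hp; simp [deshuffle] at hp; simp [hp]
  | cons k w ih =>
    intro p hp
    simp only [deshuffle, List.mem_append, List.mem_map] at hp
    rcases hp with ⟨q, hq, rfl⟩ | ⟨q, hq, rfl⟩ <;> have := ih q hq <;>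
      simp only [List.length_cons] <;> omega

/-- Noncommutative formal power series with coefficients in `A`. They are kept apart
from the functions `Word m → A`, whose multiplication is pointwise, because series are multiplied by
the shuffle product. -/
structure Ser (m : ℕ) (A : Type*) where
  /-- The coefficient of a word. -/
  coeff : Word m → A

namespace Ser

variable {m : ℕ} {A : Type*}

instance : FunLike (Ser m A) (Word m) A where
  coe := coeff
  coe_injective := by rintro ⟨c⟩ ⟨d⟩ h; exact congrArg Ser.mk h

@[ext] theorem ext {c d : Ser m A} (h : ∀ w, c w = d w) : c = d := DFunLike.ext c d h

@[simp] theorem mk_apply (c : Word m → A) (w : Word m) : (⟨c⟩ : Ser m A) w = c w := rfl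

variable [CommRing A]

instance : Zero (Ser m A) := ⟨⟨fun _ => 0⟩⟩

instance : Add (Ser m A) := ⟨fun c d => ⟨fun w => c w + d w⟩⟩

instance : Neg (Ser m A) := ⟨fun c => ⟨fun w => -c w⟩⟩

theorem add_apply (c d : Ser m A) (w : Word m) : (c + d) w = c w + d w := rfl

theorem neg_apply (c : Ser m A) (w : Word m) : (-c) w = -c w := rfl

theorem zero_apply (w : Word m) : (0 : Ser m A) w = 0 := rfl

instance : AddCommGroup (Ser m A) where
  add_assoc c d e := by ext w; exact add_assoc _ _ _
  zero_add c := by ext w; exact zero_add _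
  add_zero c := by ext w; exact add_zero _
  add_comm c d := by ext w; exact add_comm _ _
  neg_add_cancel c := by ext w; exact neg_add_cancel _
  nsmul := nsmulRec
  zsmul := zsmulRec

/-- The coefficient of a word, as an additive map. -/
def coeffHom (w : Word m) : Ser m A →+ A where
  toFun c := c w
  map_zero' := rfl
  map_add' _ _ := rfl

theorem sum_apply {ι : Type*} (s : Finset ι) (c : ι → Ser m A) (w : Word m) :
    (∑ i ∈ s, c i) w = ∑ i ∈ s, c i w :=
  map_sum (coeffHom w) c s

/-- The left derivative `x_k⁻¹ c`. -/
def lder (k : Fin (m + 1)) : Ser m A →+ Ser m A where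
  toFun c := ⟨fun w => c (k :: w)⟩
  map_zero' := rfl
  map_add' _ _ := rfl

theorem lder_apply (k : Fin (m + 1)) (c : Ser m A) (w : Word m) : lder k c w = c (k :: w) := rfl

/-- The multiplication of series is the shuffle product. -/
instance : Mul (Ser m A) :=
  ⟨fun c d => ⟨fun w => ((deshuffle w).map fun p => c p.1 * d p.2).sum⟩⟩

/-- The unit is the empty word. -/
instance : One (Ser m A) := ⟨⟨fun w => if w = [] then 1 else 0⟩⟩

theorem mul_apply (c d : Ser m A) (w : Word m) :
    (c * d) w = ((deshuffle w).map fun p => c p.1 * d p.2).sum := rfl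

theorem mul_nil (c d : Ser m A) : (c * d) [] = c [] * d [] := by
  simp [mul_apply, deshuffle]

theorem one_nil : (1 : Ser m A) [] = 1 := if_pos (c := ([] : Word m) = []) (e := (0 : A)) rfl

theorem lder_one (k : Fin (m + 1)) : lder k (1 : Ser m A) = 0 := by
  ext w
  exact if_neg (c := k :: w = []) (t := (1 : A)) (List.cons_ne_nil k w)

/-- Letters act on the shuffle algebra as derivations. -/
theorem mul_cons (c d : Ser m A) (k : Fin (m + 1)) (w : Word m) :
    (c * d) (k :: w) = (lder k c * d) w + (c * lder k d) w := by
  simp [mul_apply, deshuffle, List.map_map, Function.comp_def, lder_apply]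

/-- The shuffle product at a word only involves the coefficients of words that are not longer. -/
theorem mul_congr {c c' d d' : Ser m A} {w : Word m}
    (hc : ∀ u, u.length ≤ w.length → c u = c' u) (hd : ∀ u, u.length ≤ w.length → d u = d' u) :
    (c * d) w = (c' * d') w := by
  simp only [mul_apply]
  congr 1
  refine List.map_congr_left fun p hp => ?_
  have := deshuffle_length_add w p hp
  rw [hc p.1 (by omega), hd p.2 (by omega)]

protected theorem shuffle_add (c d e : Ser m A) : c * (d + e) = c * d + c * e := by
  ext w
  simp [mul_apply, add_apply, mul_add, List.sum_map_add]

protected theorem shuffle_comm (c d : Ser m A) : c * d = d * c := by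
  ext w
  induction w generalizing c d with
  | nil => rw [mul_nil, mul_nil, mul_comm]
  | cons k w ih => rw [mul_cons, mul_cons, ih, ih c, add_comm]

protected theorem shuffle_assoc (c d e : Ser m A) : c * d * e = c * (d * e) := by
  have right (c d e : Ser m A) : (c + d) * e = c * e + d * e := by
    rw [Ser.shuffle_comm, Ser.shuffle_add, Ser.shuffle_comm, Ser.shuffle_comm e d]
  have lder_mul' (k) (c d : Ser m A) : lder k (c * d) = lder k c * d + c * lder k d := by
    ext w
    exact mul_cons c d k w
  ext w
  induction w generalizing c d e with
  | nil => simp only [mul_nil, mul_assoc]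
  | cons k w ih =>
    simp only [mul_cons, lder_mul', right, Ser.shuffle_add, add_apply, ih, add_assoc]

protected theorem one_shuffle (c : Ser m A) : 1 * c = c := by
  ext w
  induction w generalizing c with
  | nil => rw [mul_nil, one_nil, one_mul]
  | cons k w ih =>
    rw [mul_cons, lder_one, ih, lder_apply, Ser.shuffle_comm, add_eq_right]
    simp [mul_apply, zero_apply]

instance : CommRing (Ser m A) where
  __ := (inferInstance : AddCommGroup (Ser m A))
  left_distrib := Ser.shuffle_add
  right_distrib c d e := by
    rw [Ser.shuffle_comm, Ser.shuffle_add, Ser.shuffle_comm, Ser.shuffle_comm e d]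
  zero_mul c := by ext w; simp [mul_apply, zero_apply]
  mul_zero c := by ext w; simp [mul_apply, zero_apply]
  mul_assoc := Ser.shuffle_assoc
  mul_comm := Ser.shuffle_comm
  one_mul := Ser.one_shuffle
  mul_one c := by rw [Ser.shuffle_comm, Ser.one_shuffle]

theorem lder_mul (k : Fin (m + 1)) (c d : Ser m A) :
    lder k (c * d) = lder k c * d + c * lder k d := by
  ext w
  exact mul_cons c d k w

/-! ### The modified composition product -/

/-- The modified composition product, as the solution of
`x_k⁻¹ (c ∘ d) = (x_k⁻¹ c) ∘ d` for `k ≠ 0` and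
`x₀⁻¹ (c ∘ d) = (x₀⁻¹ c) ∘ d + ∑ n, ((x_n⁻¹ c) ∘ d) ⧢ d_n`, with constant term that of `c`. -/
def compAt (c : Ser m A) (d : Fin m → Ser m A) : Word m → A
  | [] => c []
  | k :: w => compAt (lder k c) d w +
      if k = 0 then ∑ n : Fin m, ((deshuffle w).attach.map fun p =>
        compAt (lder n.succ c) d p.1.1 * d n p.1.2).sum
      else 0
termination_by w => w.length
decreasing_by
  · simp
  · exact Nat.lt_succ_of_le (deshuffle_length_le w p.1 p.2)

/-- The modified composition product as a series. -/
def comp (c : Ser m A) (d : Fin m → Ser m A) : Ser m A := ⟨compAt c d⟩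

theorem comp_nil (c : Ser m A) (d : Fin m → Ser m A) : comp c d [] = c [] := by
  rw [comp, mk_apply, compAt]

theorem comp_cons (c : Ser m A) (d : Fin m → Ser m A) (k : Fin (m + 1)) (w : Word m) :
    comp c d (k :: w) = comp (lder k c) d w +
      if k = 0 then ∑ n : Fin m, (comp (lder n.succ c) d * d n) w else 0 := by
  rw [comp, mk_apply, compAt]
  congr! 3 with _ n
  exact congrArg List.sum (List.attach_map_val (l := deshuffle w) (f := fun p =>
    comp (lder n.succ c) d p.1 * d n p.2))

theorem lder_zero_comp (c : Ser m A) (d : Fin m → Ser m A) :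
    lder 0 (comp c d) = comp (lder 0 c) d + ∑ n : Fin m, comp (lder n.succ c) d * d n := by
  ext w
  rw [lder_apply, comp_cons, if_pos rfl, add_apply, sum_apply]

theorem lder_succ_comp (n : Fin m) (c : Ser m A) (d : Fin m → Ser m A) :
    lder n.succ (comp c d) = comp (lder n.succ c) d := by
  ext w
  rw [lder_apply, comp_cons, if_neg (Fin.succ_ne_zero n), add_zero]

/-- The coefficient of a word in `comp c d` only involves the coefficients of shorter words
in `d`. -/
theorem comp_congr {c : Ser m A} {d d' : Fin m → Ser m A} {w : Word m}
    (h : ∀ n u, u.length < w.length → d n u = d' n u) : comp c d w = comp c d' w := by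
  induction hN : w.length using Nat.strong_induction_on generalizing c w with
  | _ N ih =>
    subst hN
    cases w with
    | nil => rw [comp_nil, comp_nil]
    | cons k w =>
      have key (c : Ser m A) (u : Word m) (hu : u.length ≤ w.length) :
          comp c d u = comp c d' u :=
        ih u.length (Nat.lt_succ_of_le hu)
          (fun n v hv => h n v (hv.trans (Nat.lt_succ_of_le hu))) rfl
      rw [comp_cons, comp_cons, key _ w le_rfl]
      congr! 3 with _ n
      exact mul_congr (key _) fun u hu => h n u (Nat.lt_succ_of_le hu)

theorem comp_add (c c' : Ser m A) (d : Fin m → Ser m A) :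
    comp (c + c') d = comp c d + comp c' d := by
  ext w
  induction hN : w.length using Nat.strong_induction_on generalizing c c' w with
  | _ N ih =>
    subst hN
    cases w with
    | nil => simp only [add_apply, comp_nil]
    | cons k w =>
      have key (n : Fin m) : (comp (lder n.succ (c + c')) d * d n) w =
          (comp (lder n.succ c) d * d n) w + (comp (lder n.succ c') d * d n) w := by
        rw [← add_apply, ← add_mul, map_add]
        exact mul_congr (fun u hu => ih _ (Nat.lt_succ_of_le hu) _ _ u rfl) fun _ _ => rfl
      simp only [add_apply, comp_cons, key, Finset.sum_add_distrib]
      rw [map_add, ih w.length (Nat.lt_succ_self _) _ _ w rfl, add_apply]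
      split_ifs <;> ring

/-- `comp` as an additive map in its left argument. -/
def compHom (d : Fin m → Ser m A) : Ser m A →+ Ser m A :=
  AddMonoidHom.mk' (fun c => comp c d) fun c c' => comp_add c c' d

theorem zero_comp (d : Fin m → Ser m A) : comp 0 d = 0 := (compHom d).map_zero

theorem comp_sum {ι : Type*} (s : Finset ι) (c : ι → Ser m A) (d : Fin m → Ser m A) :
    comp (∑ i ∈ s, c i) d = ∑ i ∈ s, comp (c i) d :=
  map_sum (compHom d) c s

/-- Composition distributes over the shuffle product: both sides satisfy the same recursion in the
left derivatives, which are derivations of the shuffle product. -/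
theorem mul_comp (c c' : Ser m A) (d : Fin m → Ser m A) :
    comp (c * c') d = comp c d * comp c' d := by
  ext w
  induction hN : w.length using Nat.strong_induction_on generalizing c c' w with
  | _ N ih =>
    subst hN
    cases w with
    | nil => simp only [mul_nil, comp_nil]
    | cons k w =>
      have key (c c' : Ser m A) (u : Word m) (hu : u.length ≤ w.length) :
          comp (c * c') d u = (comp c d * comp c' d) u :=
        ih u.length (Nat.lt_succ_of_le hu) c c' u rfl
      have hk (n : Fin m) : (comp (lder n.succ (c * c')) d * d n) w =
          ((comp (lder n.succ c) d * comp c' d + comp c d * comp (lder n.succ c') d) * d n) w := by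
        refine mul_congr (fun u hu => ?_) fun _ _ => rfl
        rw [lder_mul, comp_add, add_apply, key _ _ u hu, key _ _ u hu, add_apply]
      rw [← lder_apply, ← lder_apply, lder_mul]
      refine Fin.cases ?_ (fun n => ?_) k
      · rw [lder_zero_comp, lder_zero_comp, lder_zero_comp, add_apply, sum_apply,
          Finset.sum_congr rfl fun n _ => hk n, lder_mul, comp_add, add_apply, key _ _ w le_rfl,
          key _ _ w le_rfl, ← sum_apply, ← add_apply, ← add_apply]
        congr 1
        simp only [add_mul, mul_add, Finset.sum_add_distrib, Finset.sum_mul, Finset.mul_sum]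
        simp only [mul_right_comm _ (d _) (comp c' d), ← mul_assoc]
        abel
      · rw [lder_succ_comp, lder_succ_comp, lder_succ_comp, lder_mul, comp_add, add_apply,
          key _ _ w le_rfl, key _ _ w le_rfl, add_apply]

/-! ### The output feedback group -/

/-- The group product `c ⊚ d = d + c ∘ d`. -/
def gprod (c d : Fin m → Ser m A) : Fin m → Ser m A := fun i => d i + comp (c i) d

/-- Composition with `d` and then with `e` is composition with the group product: both sides satisfy
the same recursion in the left derivatives, because composition distributes over the shuffle
product. -/
theorem comp_comp (c : Ser m A) (d e : Fin m → Ser m A) :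
    comp (comp c d) e = comp c (gprod d e) := by
  ext w
  induction hN : w.length using Nat.strong_induction_on generalizing c w with
  | _ N ih =>
    subst hN
    cases w with
    | nil => simp only [comp_nil]
    | cons k w =>
      have key (c : Ser m A) (u : Word m) (hu : u.length ≤ w.length) :
          comp (comp c d) e u = comp c (gprod d e) u :=
        ih u.length (Nat.lt_succ_of_le hu) c u rfl
      rw [← lder_apply, ← lder_apply]
      refine Fin.cases ?_ (fun n => ?_) k
      · have hk (n : Fin m) : (comp (lder n.succ c) (gprod d e) * gprod d e n) w =
            (comp (comp (lder n.succ c) d) e * gprod d e n) w :=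
          mul_congr (fun u hu => (key _ u hu).symm) fun _ _ => rfl
        simp only [lder_zero_comp, comp_add, comp_sum, mul_comp, lder_succ_comp]
        rw [add_apply _ (∑ n : Fin m, comp (lder n.succ c) (gprod d e) * gprod d e n) w, sum_apply,
          ← key _ w le_rfl]
        simp only [hk]
        rw [← sum_apply, ← add_apply]
        simp only [gprod, mul_add, Finset.sum_add_distrib]
        congr 1
        abel
      · rw [lder_succ_comp, lder_succ_comp, lder_succ_comp, key _ w le_rfl]

theorem gprod_assoc (c d e : Fin m → Ser m A) :
    gprod (gprod c d) e = gprod c (gprod d e) := by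
  funext i
  simp only [gprod, comp_add]
  rw [comp_comp, add_assoc]

theorem comp_zero (c : Ser m A) : comp c 0 = c := by
  ext w
  induction w generalizing c with
  | nil => rw [comp_nil]
  | cons k w ih => simp [comp_cons, ih, lder_apply, zero_apply]

theorem gprod_zero (c : Fin m → Ser m A) : gprod c 0 = c := by
  funext i
  simp [gprod, comp_zero]

theorem zero_gprod (c : Fin m → Ser m A) : gprod 0 c = c := by
  funext i
  simp [gprod, zero_comp]

/-- The iterates, started at `0`, of the map `d ↦ -(c ∘ d)`, whose fixed point is the right inverse
of `c`. -/
def invIter (c : Fin m → Ser m A) : ℕ → Fin m → Ser m A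
  | 0 => 0
  | N + 1 => fun i => -comp (c i) (invIter c N)

/-- The map `d ↦ -(c ∘ d)` is contracting: the coefficients of words of length less than `N` no
longer change after `N` steps. -/
theorem invIter_stable (c : Fin m → Ser m A) {N N' : ℕ} (i : Fin m) (w : Word m)
    (h : w.length < N) (h' : w.length < N') : invIter c N i w = invIter c N' i w := by
  induction N generalizing N' i w with
  | zero => omega
  | succ N ih =>
    cases N' with
    | zero => omega
    | succ N' =>
      simp only [invIter, neg_apply]
      rw [comp_congr (d' := invIter c N') fun n u hu => ih n u (by omega) (by omega)]

/-- The inverse in the output feedback group. -/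
def ginv (c : Fin m → Ser m A) : Fin m → Ser m A := fun i =>
  ⟨fun w => invIter c (w.length + 1) i w⟩

theorem gprod_ginv (c : Fin m → Ser m A) : gprod c (ginv c) = 0 := by
  funext i
  ext w
  have h : ginv c i w = -comp (c i) (ginv c) w := by
    rw [ginv, mk_apply, invIter, neg_apply]
    rw [comp_congr (d' := ginv c) fun n u hu => invIter_stable c n u hu (Nat.lt_succ_self _)]
  rw [gprod, add_apply, h, neg_add_cancel]
  rfl

theorem ginv_gprod (c : Fin m → Ser m A) : gprod (ginv c) c = 0 := by
  -- the right inverse of `ginv c` is `c`, by associativity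
  have h : ginv (ginv c) = c := by
    rw [← zero_gprod (ginv (ginv c)), ← gprod_ginv c, gprod_assoc, gprod_ginv, gprod_zero]
  simpa only [h] using gprod_ginv (ginv c)

end Ser

/-! ### Real series: the defining sum of the modified composition product -/

section RealSeries

variable {m : ℕ}

/-- The words of length at most `N`. -/
def wordsLE (m : ℕ) : ℕ → Finset (Word m)
  | 0 => {[]}
  | N + 1 => insert [] ((Finset.univ ×ˢ wordsLE m N).image fun p => p.1 :: p.2)

theorem mem_wordsLE {N : ℕ} {w : Word m} : w ∈ wordsLE m N ↔ w.length ≤ N := by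
  induction N generalizing w with
  | zero => simp [wordsLE]
  | succ N ih => cases w <;> simp [wordsLE, ih]

theorem sum_wordsLE_succ {M : Type*} [AddCommMonoid M] (f : Word m → M) (N : ℕ) :
    ∑ v ∈ wordsLE m (N + 1), f v = f [] + ∑ k, ∑ v ∈ wordsLE m N, f (k :: v) := by
  rw [wordsLE, Finset.sum_insert (by simp), Finset.sum_image (by simp +contextual [Set.InjOn]),
    Finset.sum_product]

theorem shuffle_eq_mul (c d : Series m) (w : Word m) :
    shuffle c d w = ((⟨c⟩ : Ser m ℝ) * ⟨d⟩) w := rfl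

theorem modStep_cons (d : Fin m → Series m) (k j : Fin (m + 1)) (e : Series m) (w : Word m) :
    modStep d k e (j :: w) = (if j = k then e w else 0) +
      if j = 0 then shuffle ((Fin.cons 0 d : Fin (m + 1) → Series m) k) e w else 0 := rfl

/-- The maps `modStep d k` raise the order of a series, so a word contributes to the
modified composition product only at words that are at least as long. -/
theorem modWord_eq_zero (d : Fin m → Series m) (e : Series m) {v w : Word m}
    (h : w.length < v.length) : modWord d v e w = 0 := by
  induction v generalizing w with
  | nil => simp at h
  | cons k v ih =>
    cases w with
    | nil => exact add_zero (0 : ℝ)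
    | cons j w =>
      have h' : w.length < v.length := by simpa using h
      rw [modWord, modStep_cons, ih h', shuffle_eq_mul]
      have hs : ((⟨(Fin.cons 0 d : Fin (m + 1) → Series m) k⟩ : Ser m ℝ) * ⟨modWord d v e⟩) w =
          ((⟨(Fin.cons 0 d : Fin (m + 1) → Series m) k⟩ : Ser m ℝ) * 0) w :=
        Ser.mul_congr (fun _ _ => rfl) fun u hu => ih (hu.trans_lt h')
      rw [hs, mul_zero, Ser.zero_apply, ite_self, ite_self, add_zero]

theorem sum_mul_list_sum {ι κ : Type*} (s : Finset ι) (l : List κ) (a : ι → ℝ) (x : κ → ℝ)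
    (y : ι → κ → ℝ) :
    ∑ v ∈ s, a v * (l.map fun p => x p * y v p).sum =
      (l.map fun p => (∑ v ∈ s, a v * y v p) * x p).sum := by
  induction l with
  | nil => simp
  | cons p l ih =>
    simp only [List.map_cons, List.sum_cons, mul_add, Finset.sum_add_distrib, ih, Finset.sum_mul]
    congr 1
    exact Finset.sum_congr rfl fun v _ => by ring

/-- The finite part of the defining sum that is relevant for the word `w` obeys the recursion of
`Ser.comp`. -/
theorem sum_modWord (c : Series m) (d : Fin m → Series m) {N : ℕ} {w : Word m}
    (h : w.length ≤ N) :
    ∑ v ∈ wordsLE m N, c v * modWord d v oneSeries w =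
      Ser.comp ⟨c⟩ (fun n => ⟨d n⟩) w := by
  induction N generalizing c w with
  | zero =>
    obtain rfl : w = [] := by simpa using h
    simp [wordsLE, Ser.comp_nil, modWord, oneSeries]
  | succ N ih =>
    rw [sum_wordsLE_succ]
    cases w with
    | nil =>
      have h0 (k : Fin (m + 1)) (e : Series m) : modStep d k e [] = 0 := add_zero (0 : ℝ)
      simp [h0, Ser.comp_nil, modWord, oneSeries]
    | cons j w =>
      have hw : w.length ≤ N := by simpa using h
      have hsh (k : Fin (m + 1)) : ∑ v ∈ wordsLE m N, c (k :: v) *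
          shuffle ((Fin.cons 0 d : Fin (m + 1) → Series m) k) (modWord d v oneSeries) w =
          (Ser.comp (Ser.lder k ⟨c⟩) (fun n => ⟨d n⟩) *
            ⟨(Fin.cons 0 d : Fin (m + 1) → Series m) k⟩) w := by
        simp only [shuffle]
        rw [sum_mul_list_sum, mul_comm, Ser.mul_apply]
        congr 1
        refine List.map_congr_left fun p hp => ?_
        have := deshuffle_length_add w p hp
        rw [ih (fun v => c (k :: v)) (by omega), mul_comm]
        rfl
      have h0 : (oneSeries : Series m) (j :: w) = 0 := if_neg (List.cons_ne_nil j w)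
      simp only [modWord, h0, mul_zero, zero_add, modStep_cons, mul_add, mul_ite,
        Finset.sum_add_distrib]
      rw [Ser.comp_cons]
      congr 1
      · rw [Finset.sum_eq_single j (fun k _ hk => by simp [hk.symm]) (by simp)]
        simp only [if_true]
        exact ih (fun v => c (j :: v)) hw
      · split_ifs
        · simp only [hsh]
          rw [Fin.sum_univ_succ]
          have : (⟨(Fin.cons 0 d : Fin (m + 1) → Series m) 0⟩ : Ser m ℝ) = 0 := rfl
          rw [this, mul_zero, Ser.zero_apply, zero_add]
          rfl
        · simp

theorem modComp_eq_comp (c : Series m) (d : Fin m → Series m) (w : Word m) :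
    modComp c d w = Ser.comp ⟨c⟩ (fun n => ⟨d n⟩) w := by
  rw [modComp, ← sum_modWord c d le_rfl]
  refine finsum_eq_sum_of_support_subset _ fun v hv => ?_
  rw [Finset.mem_coe, mem_wordsLE]
  by_contra hlt
  exact hv (by simp only [modWord_eq_zero d oneSeries (not_le.1 hlt), mul_zero])

end RealSeries

/-! ### The coordinate Hopf algebra -/

section Coordinates

variable {m : ℕ} {A : Type*} [CommRing A] [Algebra ℝ A]

/-- The `A`-valued point of the output feedback group given by a character of `H` with values
in `A`. -/
def point (f : CoordAlgebra m →ₐ[ℝ] A) : Fin m → Ser m A :=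
  fun i => ⟨fun w => f (MvPolynomial.X ⟨i, w⟩)⟩

/-- Algebra homomorphisms on `H` are determined by their points. -/
theorem point_injective : Function.Injective (point : (CoordAlgebra m →ₐ[ℝ] A) → _) := by
  intro f g h
  refine MvPolynomial.algHom_ext fun a => ?_
  exact congrArg (fun p : Fin m → Ser m A => p a.idx a.word) h

theorem tildeWord_nil (i : Fin m) :
    tildeWord i [] = Finsupp.single (⟨i, []⟩ : Coord m) (1 : ℝ) ⊗ₜ[ℝ] 1 := by
  rw [tildeWord]

theorem tildeWord_cons (i : Fin m) (k : Fin (m + 1)) (w : Word m) :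
    tildeWord i (k :: w) = TensorProduct.map (theta k) LinearMap.id (tildeWord i w) +
      if k = 0 then
        ∑ n : Fin m, ((deshuffle w).map fun p =>
          TensorProduct.map (theta n.succ)
            (LinearMap.mulRight ℝ (MvPolynomial.X ⟨n, p.2⟩ : CoordAlgebra m))
            (tildeWord i p.1)).sum
      else 0 := by
  rw [tildeWord]
  congr! 3 with _ n
  exact congrArg List.sum (List.attach_map_val (l := deshuffle w) (f := fun p =>
    TensorProduct.map (theta n.succ)
      (LinearMap.mulRight ℝ (MvPolynomial.X ⟨n, p.2⟩ : CoordAlgebra m)) (tildeWord i p.1)))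

theorem theta_single (k : Fin (m + 1)) (a : Coord m) (r : ℝ) :
    theta k (Finsupp.single a r) = Finsupp.single ⟨a.idx, k :: a.word⟩ r :=
  Finsupp.mapDomain_single

/-- The value of a linear form in the first and a character in the second factor on the
coproduct `Δ̃` is a coefficient of the modified composition product. -/
theorem tildeWord_eval (L : CoordSpan m →ₗ[ℝ] A) (g : CoordAlgebra m →ₐ[ℝ] A) (i : Fin m)
    (w : Word m) :
    LinearMap.mul' ℝ A (TensorProduct.map L g.toLinearMap (tildeWord i w)) =
      Ser.comp ⟨fun v => L (Finsupp.single ⟨i, v⟩ 1)⟩ (point g) w := by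
  induction hN : w.length using Nat.strong_induction_on generalizing L w with
  | _ N ih =>
    subst hN
    cases w with
    | nil => simp [tildeWord_nil, Ser.comp_nil]
    | cons k w =>
      have hL (k : Fin (m + 1)) : (⟨fun v => (L ∘ₗ theta k) (Finsupp.single ⟨i, v⟩ 1)⟩ : Ser m A) =
          Ser.lder k ⟨fun v => L (Finsupp.single ⟨i, v⟩ 1)⟩ := by
        ext v
        simp only [Ser.lder_apply, Ser.mk_apply, LinearMap.comp_apply, theta_single]
      have hθ (k : Fin (m + 1)) (t : CoordSpan m ⊗[ℝ] CoordAlgebra m) :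
          TensorProduct.map L g.toLinearMap (TensorProduct.map (theta k) LinearMap.id t) =
            TensorProduct.map (L ∘ₗ theta k) g.toLinearMap t := by
        rw [← LinearMap.comp_apply, ← TensorProduct.map_comp, LinearMap.comp_id]
      have hμ (k : Fin (m + 1)) (a : Coord m) (t : CoordSpan m ⊗[ℝ] CoordAlgebra m) :
          LinearMap.mul' ℝ A (TensorProduct.map L g.toLinearMap (TensorProduct.map (theta k)
            (LinearMap.mulRight ℝ (MvPolynomial.X a)) t)) =
          LinearMap.mul' ℝ A (TensorProduct.map (L ∘ₗ theta k) g.toLinearMap t) *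
            g (MvPolynomial.X a) := by
        induction t with
        | zero => simp
        | add x y hx hy => simp only [map_add, hx, hy, add_mul]
        | tmul x y => simp [mul_assoc]
      rw [tildeWord_cons, map_add, map_add, hθ, ih _ (Nat.lt_succ_self _) _ _ rfl, hL,
        Ser.comp_cons]
      congr 1
      split_ifs
      · rw [map_sum, map_sum]
        refine Finset.sum_congr rfl fun n _ => ?_
        rw [map_list_sum, map_list_sum, List.map_map, List.map_map, Ser.mul_apply]
        congr 1
        refine List.map_congr_left fun p hp => ?_
        have := deshuffle_length_add w p hp
        rw [Function.comp_apply, Function.comp_apply, hμ,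
          ih p.1.length (Nat.lt_succ_of_le (by omega)) _ _ rfl, hL]
        rfl
      · simp

theorem coordTilde_single (a : Coord m) :
    coordTilde (Finsupp.single a 1) = tildeWord a.idx a.word := by
  rw [coordTilde, Finsupp.linearCombination_single, one_smul]

theorem incl_single {σ : Type*} (a : σ) (r : ℝ) :
    incl σ (Finsupp.single a r) = r • MvPolynomial.X a :=
  Finsupp.linearCombination_single ℝ r a

/-- The coproduct of `H` as an algebra homomorphism. -/
def coordComul (m : ℕ) : CoordAlgebra m →ₐ[ℝ] CoordAlgebra m ⊗[ℝ] CoordAlgebra m :=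
  MvPolynomial.aeval fun a : Coord m =>
    TensorProduct.map (incl (Coord m)) LinearMap.id (coordTilde (Finsupp.single a (1 : ℝ))) +
      (1 : CoordAlgebra m) ⊗ₜ[ℝ] (MvPolynomial.X a : CoordAlgebra m)

/-- The counit of `H` as an algebra homomorphism. -/
def coordCounit (m : ℕ) : CoordAlgebra m →ₐ[ℝ] ℝ :=
  MvPolynomial.aeval fun _ => 0

/-- The coproduct of `H` represents the product of the output feedback group: characters of `H`
with values in `A` multiply like the corresponding `A`-valued points. -/
theorem point_comp_coordComul (F : CoordAlgebra m ⊗[ℝ] CoordAlgebra m →ₐ[ℝ] A) :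
    point (F.comp (coordComul m)) =
      Ser.gprod (point (F.comp Algebra.TensorProduct.includeLeft))
        (point (F.comp Algebra.TensorProduct.includeRight)) := by
  have hF : F.toLinearMap ∘ₗ TensorProduct.map (incl (Coord m)) LinearMap.id =
      LinearMap.mul' ℝ A ∘ₗ TensorProduct.map
        ((F.comp Algebra.TensorProduct.includeLeft).toLinearMap ∘ₗ incl (Coord m))
        (F.comp Algebra.TensorProduct.includeRight).toLinearMap := by
    refine TensorProduct.ext' fun x y => ?_
    simp [← map_mul]
  funext i
  ext w
  simp only [point, Ser.mk_apply, AlgHom.comp_apply, coordComul, MvPolynomial.aeval_X, map_add,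
    coordTilde_single, Ser.gprod, Ser.add_apply]
  rw [add_comm]
  congr 1
  have := LinearMap.congr_fun hF (tildeWord i w)
  rw [LinearMap.comp_apply, LinearMap.comp_apply, tildeWord_eval] at this
  refine this.trans ?_
  simp only [LinearMap.comp_apply, incl_single, one_smul]
  rfl

theorem point_coordCounit : point ((Algebra.ofId ℝ A).comp (coordCounit m)) = 0 := by
  funext i
  ext w
  simp [point, coordCounit, Ser.zero_apply]

/-- The antipode of `H`: the inverse of the generic point of the output feedback group. -/
def coordAntipode (m : ℕ) : CoordAlgebra m →ₐ[ℝ] CoordAlgebra m :=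
  MvPolynomial.aeval fun a => Ser.ginv (point (AlgHom.id ℝ (CoordAlgebra m))) a.idx a.word

theorem point_coordAntipode :
    point (coordAntipode m) = Ser.ginv (point (AlgHom.id ℝ (CoordAlgebra m))) := by
  funext i
  ext w
  simp [point, coordAntipode]

/-- Coassociativity is the associativity of the group product, applied to the three canonical points
of `H` with values in `H ⊗ (H ⊗ H)`. -/
theorem coordComul_coassoc :
    (Algebra.TensorProduct.assoc ℝ ℝ ℝ (CoordAlgebra m) (CoordAlgebra m)
      (CoordAlgebra m)).toAlgHom.comp
        ((Algebra.TensorProduct.map (coordComul m) (AlgHom.id ℝ _)).comp (coordComul m)) =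
      (Algebra.TensorProduct.map (AlgHom.id ℝ _) (coordComul m)).comp (coordComul m) := by
  refine point_injective
    (A := CoordAlgebra m ⊗[ℝ] (CoordAlgebra m ⊗[ℝ] CoordAlgebra m)) ?_
  set as := (Algebra.TensorProduct.assoc ℝ ℝ ℝ (CoordAlgebra m) (CoordAlgebra m)
      (CoordAlgebra m)).toAlgHom with has
  have h1 : (as.comp (Algebra.TensorProduct.map (coordComul m) (AlgHom.id ℝ _))).comp
      Algebra.TensorProduct.includeLeft =
      (as.comp Algebra.TensorProduct.includeLeft).comp (coordComul m) := by
    ext; simp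
  have h2 : (Algebra.TensorProduct.map (AlgHom.id ℝ (CoordAlgebra m)) (coordComul m)).comp
      Algebra.TensorProduct.includeRight =
      (Algebra.TensorProduct.includeRight (R := ℝ) (A := CoordAlgebra m)).comp
        (coordComul m) := by
    ext; simp
  rw [← AlgHom.comp_assoc, point_comp_coordComul, point_comp_coordComul, h1, h2,
    point_comp_coordComul, point_comp_coordComul, Ser.gprod_assoc]
  congr 2
  · ext; simp [has, Algebra.TensorProduct.one_def]
  · congr 1
    ext; simp [has, Algebra.TensorProduct.one_def]

theorem comul_evalAtPair (f : CoordAlgebra m) (c d : Fin m → Series m) :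
    evalAtPair c d (CoalgebraStruct.comul (R := ℝ) f) = evalAt (feedbackProd c d) f := by
  have h : (evalAtPair c d).comp (coordComul m) = evalAt (feedbackProd c d) := by
    apply point_injective
    rw [point_comp_coordComul]
    funext i
    ext w
    have hl : point ((evalAtPair c d).comp Algebra.TensorProduct.includeLeft) =
        fun i => (⟨c i⟩ : Ser m ℝ) := by
      funext i
      ext w
      simp [point, evalAtPair, evalAt, Coord.toFun]
    have hr : point ((evalAtPair c d).comp Algebra.TensorProduct.includeRight) =
        fun i => (⟨d i⟩ : Ser m ℝ) := by
      funext i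
      ext w
      simp [point, evalAtPair, evalAt, Coord.toFun]
    rw [hl, hr]
    simp [Ser.gprod, Ser.add_apply, point, evalAt, Coord.toFun, feedbackProd, modComp_eq_comp]
  exact AlgHom.congr_fun h f

theorem coord_isHopfAlgebra :
    IsHopfAlgebra (CoordAlgebra m) (coordAntipode m).toLinearMap where
  coassoc := congrArg AlgHom.toLinearMap (coordComul_coassoc (m := m))
  rTensor_counit_comp_comul := by
    have : (Algebra.TensorProduct.map (coordCounit m) (AlgHom.id ℝ (CoordAlgebra m))).comp
        (coordComul m) = Algebra.TensorProduct.includeRight := by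
      apply point_injective
      rw [point_comp_coordComul]
      convert Ser.zero_gprod _
      · exact point_coordCounit (A := ℝ ⊗[ℝ] CoordAlgebra m)
      · ext; simp
    exact congrArg AlgHom.toLinearMap this
  lTensor_counit_comp_comul := by
    have : (Algebra.TensorProduct.map (AlgHom.id ℝ (CoordAlgebra m)) (coordCounit m)).comp
        (coordComul m) = Algebra.TensorProduct.includeLeft := by
      apply point_injective
      rw [point_comp_coordComul]
      convert Ser.gprod_zero _
      · rw [← point_coordCounit (A := CoordAlgebra m ⊗[ℝ] ℝ)]
        congr 1
        ext; simp [coordCounit]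
      · ext; simp
    exact congrArg AlgHom.toLinearMap this
  counit_one := map_one (coordCounit m)
  counit_mul := map_mul (coordCounit m)
  comul_one := map_one (coordComul m)
  comul_mul := map_mul (coordComul m)
  antipode_left := by
    have : ((Algebra.TensorProduct.lmul' ℝ (S := CoordAlgebra m)).comp
        (Algebra.TensorProduct.map (coordAntipode m) (AlgHom.id ℝ (CoordAlgebra m)))).comp
        (coordComul m) = (Algebra.ofId ℝ _).comp (coordCounit m) := by
      have hl : ((Algebra.TensorProduct.lmul' ℝ (S := CoordAlgebra m)).comp
          (Algebra.TensorProduct.map (coordAntipode m) (AlgHom.id ℝ (CoordAlgebra m)))).comp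
          Algebra.TensorProduct.includeLeft = coordAntipode m := by
        ext; simp
      have hr : ((Algebra.TensorProduct.lmul' ℝ (S := CoordAlgebra m)).comp
          (Algebra.TensorProduct.map (coordAntipode m) (AlgHom.id ℝ (CoordAlgebra m)))).comp
          Algebra.TensorProduct.includeRight = AlgHom.id ℝ (CoordAlgebra m) := by
        ext; simp
      apply point_injective
      rw [point_comp_coordComul, point_coordCounit]
      rw [hl, hr, point_coordAntipode, Ser.ginv_gprod]
    exact congrArg AlgHom.toLinearMap this
  antipode_right := by
    have : ((Algebra.TensorProduct.lmul' ℝ (S := CoordAlgebra m)).comp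
        (Algebra.TensorProduct.map (AlgHom.id ℝ (CoordAlgebra m)) (coordAntipode m))).comp
        (coordComul m) = (Algebra.ofId ℝ _).comp (coordCounit m) := by
      have hl : ((Algebra.TensorProduct.lmul' ℝ (S := CoordAlgebra m)).comp
          (Algebra.TensorProduct.map (AlgHom.id ℝ (CoordAlgebra m)) (coordAntipode m))).comp
          Algebra.TensorProduct.includeLeft = AlgHom.id ℝ (CoordAlgebra m) := by
        ext; simp
      have hr : ((Algebra.TensorProduct.lmul' ℝ (S := CoordAlgebra m)).comp
          (Algebra.TensorProduct.map (AlgHom.id ℝ (CoordAlgebra m)) (coordAntipode m))).comp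
          Algebra.TensorProduct.includeRight = coordAntipode m := by
        ext; simp
      apply point_injective
      rw [point_comp_coordComul, point_coordCounit]
      rw [hl, hr, point_coordAntipode, Ser.gprod_ginv]
    exact congrArg AlgHom.toLinearMap this

end Coordinates

/-! ### Extractions in a finite linearly ordered set -/

section Extractions

variable {α : Type*} [LinearOrder α] {m : ℕ}

/-- The word of the decorations `d` of the elements of `s`, in increasing order. -/
def readWord (s : Finset α) (d : α → Fin (m + 1)) : Word m := s.sort.map d

theorem readWord_empty (d : α → Fin (m + 1)) : readWord ∅ d = [] := by simp [readWord]

theorem readWord_insert {a : α} {s : Finset α} (h : ∀ x ∈ s, a < x) (d : α → Fin (m + 1)) :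
    readWord (insert a s) d = d a :: readWord s d := by
  rw [readWord, Finset.sort_insert _ (fun x hx => (h x hx).le) fun ha => lt_irrefl a (h a ha)]
  rfl

theorem readWord_congr {s s' : Finset α} {d d' : α → Fin (m + 1)} (hs : s = s')
    (h : ∀ v ∈ s, d v = d' v) : readWord s d = readWord s' d' := by
  subst hs
  exact List.map_congr_left fun v hv => h v ((Finset.mem_sort _).1 hv)

/-- The deshuffling of a word is the sum over all subsets of the set of its letters. -/
theorem sum_deshuffle_readWord {M : Type*} [AddCommMonoid M] (s : Finset α) (d : α → Fin (m + 1))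
    (f : Word m × Word m → M) :
    ((deshuffle (readWord s d)).map f).sum =
      ∑ J ∈ s.powerset, f (readWord (s \ J) d, readWord J d) := by
  induction s using Finset.induction_on_min generalizing f with
  | empty => simp [readWord_empty, deshuffle]
  | insert a s h ih =>
    have ha : a ∉ s := fun ha => lt_irrefl a (h a ha)
    rw [readWord_insert h, deshuffle, List.map_append, List.sum_append, List.map_map,
      List.map_map, ih, ih, Finset.sum_powerset_insert ha]
    congr 1 <;> refine Finset.sum_congr rfl fun J hJ => ?_ <;> rw [Finset.mem_powerset] at hJ
    · rw [Finset.insert_sdiff_of_notMem _ fun h => ha (hJ h),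
        readWord_insert fun x hx => h x (Finset.mem_sdiff.1 hx).1]
      rfl
    · rw [readWord_insert fun x hx => h x (hJ hx), Finset.insert_sdiff_insert,
        Finset.sdiff_insert_of_notMem ha]
      rfl

/-- The elements of `J` other than its minimum. -/
def nonMin (J : Finset α) : Finset α := by
  classical exact J.filter fun v => ¬ IsLeast (J : Set α) v

theorem mem_nonMin {J : Finset α} {v : α} :
    v ∈ nonMin J ↔ v ∈ J ∧ ¬ IsLeast (J : Set α) v := by
  classical
  rw [nonMin, Finset.mem_filter]

theorem isLeast_insert {a : α} {J : Finset α} (h : ∀ x ∈ J, a < x) (v : α) :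
    IsLeast ((insert a J : Finset α) : Set α) v ↔ v = a := by
  have ha : IsLeast ((insert a J : Finset α) : Set α) a := by
    refine ⟨by simp, fun x hx => ?_⟩
    rcases Finset.mem_insert.1 hx with rfl | hx
    exacts [le_rfl, (h x hx).le]
  exact ⟨fun hv => hv.unique ha, fun hv => hv ▸ ha⟩

theorem nonMin_insert {a : α} {J : Finset α} (h : ∀ x ∈ J, a < x) : nonMin (insert a J) = J := by
  ext v
  rw [mem_nonMin, isLeast_insert h, Finset.mem_insert]
  refine ⟨fun hv => hv.1.resolve_left hv.2, fun hv => ⟨Or.inr hv, ?_⟩⟩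
  rintro rfl
  exact lt_irrefl v (h v hv)

/-- The admissible extractions of `s` together with a choice of an index for each of the extracted
subsets: sets of pairs of an admissible subset and an index. -/
def decoratedExtractions (s : Finset α) (d : α → Fin (m + 1)) :
    Finset (Finset (Finset α × Fin m)) := by
  classical exact (s.powerset ×ˢ Finset.univ).powerset.filter fun P =>
    (∀ p ∈ P, ∃ v, IsLeast (p.1 : Set α) v ∧ d v = 0) ∧
      ∀ p ∈ P, ∀ q ∈ P, p ≠ q → Disjoint p.1 q.1

theorem mem_decoratedExtractions {s : Finset α} {d : α → Fin (m + 1)}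
    {P : Finset (Finset α × Fin m)} :
    P ∈ decoratedExtractions s d ↔ (∀ p ∈ P, p.1 ⊆ s) ∧
      (∀ p ∈ P, ∃ v, IsLeast (p.1 : Set α) v ∧ d v = 0) ∧
        ∀ p ∈ P, ∀ q ∈ P, p ≠ q → Disjoint p.1 q.1 := by
  classical
  rw [decoratedExtractions, Finset.mem_filter, Finset.mem_powerset]
  refine and_congr_left fun _ => ⟨fun h p hp => ?_, fun h p hp => ?_⟩
  · simpa using (Finset.mem_product.1 (h hp)).1
  · simpa using h p hp

/-- The elements that remain after the extraction `P`. -/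
def remaining (s : Finset α) (P : Finset (Finset α × Fin m)) : Finset α :=
  s.filter fun v => ∀ p ∈ P, v ∉ nonMin p.1

open Classical in
/-- The decorations after the extraction `P`: the minimum of an extracted subset is redecorated by
its index. The choice is unambiguous when the extracted subsets are disjoint. -/
def redecorate (d : α → Fin (m + 1)) (P : Finset (Finset α × Fin m)) (v : α) : Fin (m + 1) :=
  if h : ∃ p ∈ P, IsLeast (p.1 : Set α) v then h.choose.2.succ else d v

theorem redecorate_of_isLeast (d : α → Fin (m + 1)) {P : Finset (Finset α × Fin m)}
    (hP : ∀ p ∈ P, ∀ q ∈ P, p ≠ q → Disjoint p.1 q.1) {p : Finset α × Fin m} (hp : p ∈ P) {v : α}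
    (hv : IsLeast (p.1 : Set α) v) : redecorate d P v = p.2.succ := by
  have h : ∃ p ∈ P, IsLeast (p.1 : Set α) v := ⟨p, hp, hv⟩
  rw [redecorate, dif_pos h]
  by_contra hne
  have hpq : h.choose ≠ p := fun h' => hne (by rw [h'])
  exact Finset.disjoint_left.1 (hP _ h.choose_spec.1 _ hp hpq) h.choose_spec.2.1 hv.1

theorem redecorate_of_forall_not (d : α → Fin (m + 1)) {P : Finset (Finset α × Fin m)} {v : α}
    (h : ∀ p ∈ P, ¬ IsLeast (p.1 : Set α) v) : redecorate d P v = d v :=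
  dif_neg fun ⟨p, hp, hv⟩ => h p hp hv

/-- The contribution of the extraction `P` to the coproduct `Δ̃`. -/
def extractionTerm (i : Fin m) (s : Finset α) (d : α → Fin (m + 1))
    (P : Finset (Finset α × Fin m)) : CoordSpan m ⊗[ℝ] CoordAlgebra m :=
  Finsupp.single (⟨i, readWord (remaining s P) (redecorate d P)⟩ : Coord m) (1 : ℝ) ⊗ₜ[ℝ]
    ∏ p ∈ P, (MvPolynomial.X ⟨p.2, readWord (nonMin p.1) d⟩ : CoordAlgebra m)

/-- The extractions that leave the first vertex `a` alone contribute `(θ ⊗ id) Δ̃`. -/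
theorem extractionTerm_insert (i : Fin m) {a : α} {s : Finset α} (h : ∀ x ∈ s, a < x)
    (d : α → Fin (m + 1)) {P : Finset (Finset α × Fin m)} (hP : P ∈ decoratedExtractions s d) :
    extractionTerm i (insert a s) d P =
      TensorProduct.map (theta (d a)) LinearMap.id (extractionTerm i s d P) := by
  rw [mem_decoratedExtractions] at hP
  have ha : a ∉ s := fun ha => lt_irrefl a (h a ha)
  have hrem : remaining (insert a s) P = insert a (remaining s P) := by
    rw [remaining, remaining, Finset.filter_insert, if_pos]
    exact fun p hp hap => ha (hP.1 p hp (mem_nonMin.1 hap).1)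
  rw [extractionTerm, extractionTerm, TensorProduct.map_tmul, theta_single, hrem,
    readWord_insert (s := remaining s P) fun x hx => h x (Finset.mem_filter.1 hx).1,
    redecorate_of_forall_not d fun p hp hap => ha (hP.1 p hp hap.1)]
  rfl

theorem insert_mem_decoratedExtractions {a : α} {s : Finset α} (h : ∀ x ∈ s, a < x)
    {d : α → Fin (m + 1)} (hd : d a = 0) {J : Finset α} (hJ : J ⊆ s) (n : Fin m)
    {Q : Finset (Finset α × Fin m)} (hQ : Q ∈ decoratedExtractions (s \ J) d) :
    insert (insert a J, n) Q ∈ decoratedExtractions (insert a s) d := by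
  have ha : a ∉ s := fun ha => lt_irrefl a (h a ha)
  rw [mem_decoratedExtractions] at hQ ⊢
  refine ⟨?_, ?_, ?_⟩
  · rw [Finset.forall_mem_insert]
    exact ⟨Finset.insert_subset_insert a hJ, fun q hq =>
      (hQ.1 q hq).trans (Finset.sdiff_subset.trans (Finset.subset_insert a s))⟩
  · rw [Finset.forall_mem_insert]
    exact ⟨⟨a, (isLeast_insert (fun x hx => h x (hJ hx)) a).2 rfl, hd⟩, hQ.2.1⟩
  · have key : ∀ q ∈ Q, Disjoint (insert a J) q.1 := fun q hq => by
      rw [Finset.disjoint_insert_left]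
      exact ⟨fun haq => ha (Finset.mem_sdiff.1 (hQ.1 q hq haq)).1,
        (Finset.disjoint_of_subset_left (hQ.1 q hq) Finset.sdiff_disjoint).symm⟩
    simp only [Finset.forall_mem_insert]
    exact ⟨⟨fun h' => absurd rfl h', fun q hq _ => key q hq⟩,
      fun q hq => ⟨fun _ => (key q hq).symm, hQ.2.2 q hq⟩⟩

/-- The extractions in which the first vertex `a` is the minimum of an extracted subset
`{a} ∪ J` with index `n` contribute `(θ_n ⊗ μ) (Δ̃ ⊗ id) Δ^n`. -/
theorem extractionTerm_insert_insert (i : Fin m) {a : α} {s : Finset α} (h : ∀ x ∈ s, a < x)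
    {d : α → Fin (m + 1)} (hd : d a = 0) {J : Finset α} (hJ : J ⊆ s) (n : Fin m)
    {Q : Finset (Finset α × Fin m)} (hQ : Q ∈ decoratedExtractions (s \ J) d) :
    extractionTerm i (insert a s) d (insert (insert a J, n) Q) =
      TensorProduct.map (theta n.succ)
        (LinearMap.mulRight ℝ (MvPolynomial.X ⟨n, readWord J d⟩ : CoordAlgebra m))
        (extractionTerm i (s \ J) d Q) := by
  have hP := insert_mem_decoratedExtractions h hd hJ n hQ
  rw [mem_decoratedExtractions] at hQ hP
  have ha : a ∉ s := fun ha => lt_irrefl a (h a ha)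
  have hJa : ∀ x ∈ J, a < x := fun x hx => h x (hJ hx)
  have haQ : ∀ q ∈ Q, a ∉ q.1 := fun q hq haq => ha (Finset.mem_sdiff.1 (hQ.1 q hq haq)).1
  have hn : (insert a J, n) ∉ Q := fun h' => haQ _ h' (Finset.mem_insert_self _ _)
  have hrem : remaining (insert a s) (insert (insert a J, n) Q) =
      insert a (remaining (s \ J) Q) := by
    ext v
    simp only [remaining, Finset.mem_filter, Finset.forall_mem_insert, nonMin_insert hJa,
      Finset.mem_insert (a := v), Finset.mem_sdiff]
    constructor
    · rintro ⟨rfl | hv, hvJ, hvQ⟩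
      exacts [Or.inl rfl, Or.inr ⟨⟨hv, hvJ⟩, hvQ⟩]
    · rintro (rfl | ⟨⟨hv, hvJ⟩, hvQ⟩)
      · exact ⟨Or.inl rfl, fun hv => ha (hJ hv), fun q hq hv => haQ q hq (mem_nonMin.1 hv).1⟩
      · exact ⟨Or.inr hv, hvJ, hvQ⟩
  have hlt : ∀ x ∈ remaining (s \ J) Q, a < x := fun x hx =>
    h x (Finset.mem_sdiff.1 (Finset.mem_filter.1 hx).1).1
  have hdec : ∀ v ∈ remaining (s \ J) Q,
      redecorate d (insert (insert a J, n) Q) v = redecorate d Q v := by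
    intro v hv
    by_cases hq : ∃ q ∈ Q, IsLeast (q.1 : Set α) v
    · obtain ⟨q, hq, hqv⟩ := hq
      rw [redecorate_of_isLeast d hQ.2.2 hq hqv,
        redecorate_of_isLeast d hP.2.2 (Finset.mem_insert_of_mem hq) hqv]
    · push Not at hq
      rw [redecorate_of_forall_not d hq, redecorate_of_forall_not]
      rw [Finset.forall_mem_insert]
      exact ⟨fun hv' => (hlt v hv).ne' ((isLeast_insert hJa v).1 hv'), hq⟩
  rw [extractionTerm, extractionTerm, TensorProduct.map_tmul, theta_single, hrem,
    readWord_insert hlt, readWord_congr rfl hdec, Finset.prod_insert hn, nonMin_insert hJa,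
    redecorate_of_isLeast d hP.2.2 (Finset.mem_insert_self _ _) ((isLeast_insert hJa a).2 rfl),
    LinearMap.mulRight_apply, mul_comm]

/-- The recursion for the sum over extractions that comes from the first vertex `a` of
`{a} ∪ s`. -/
theorem sum_decoratedExtractions_insert {M : Type*} [AddCommMonoid M] {a : α} {s : Finset α}
    (h : ∀ x ∈ s, a < x) (d : α → Fin (m + 1)) (f : Finset (Finset α × Fin m) → M) :
    ∑ P ∈ decoratedExtractions (insert a s) d, f P = ∑ P ∈ decoratedExtractions s d, f P +
      if d a = 0 then ∑ n : Fin m, ∑ J ∈ s.powerset, ∑ Q ∈ decoratedExtractions (s \ J) d,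
        f (insert (insert a J, n) Q) else 0 := by
  classical
  have ha : a ∉ s := fun ha => lt_irrefl a (h a ha)
  rw [← Finset.sum_filter_add_sum_filter_not (decoratedExtractions (insert a s) d)
    fun P => ∀ p ∈ P, a ∉ p.1]
  congr 1
  · refine Finset.sum_congr ?_ fun _ _ => rfl
    ext P
    rw [Finset.mem_filter, mem_decoratedExtractions, mem_decoratedExtractions]
    constructor
    · rintro ⟨⟨h1, h2⟩, h3⟩
      exact ⟨fun p hp => (Finset.subset_insert_iff_of_notMem (h3 p hp)).1 (h1 p hp), h2⟩
    · rintro ⟨h1, h2⟩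
      exact ⟨⟨fun p hp => (h1 p hp).trans (Finset.subset_insert a s), h2⟩,
        fun p hp hap => ha (h1 p hp hap)⟩
  split_ifs with hd
  · rw [← Finset.sum_product', Finset.sum_sigma']
    symm
    have hmem : ∀ x ∈ (Finset.univ ×ˢ s.powerset).sigma
        fun x : Fin m × Finset α => decoratedExtractions (m := m) (s \ x.2) d,
        (∀ y ∈ x.1.2, a < y) ∧ (∀ q ∈ x.2, a ∉ q.1) ∧ x.1.2 ⊆ s ∧
          x.2 ∈ decoratedExtractions (s \ x.1.2) d := by
      intro x hx
      obtain ⟨hJ, hQ⟩ := Finset.mem_sigma.1 hx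
      have hJ' : x.1.2 ⊆ s := Finset.mem_powerset.1 (Finset.mem_product.1 hJ).2
      exact ⟨fun y hy => h y (hJ' hy), fun q hq haq =>
        ha (Finset.mem_sdiff.1 ((mem_decoratedExtractions.1 hQ).1 q hq haq)).1, hJ', hQ⟩
    refine Finset.sum_bij (fun x _ => insert (insert a x.1.2, x.1.1) x.2) ?_ ?_ ?_
      fun _ _ => rfl
    · intro x hx
      obtain ⟨-, -, hJ, hQ⟩ := hmem x hx
      exact Finset.mem_filter.2 ⟨insert_mem_decoratedExtractions h hd hJ x.1.1 hQ,
        fun h' => h' _ (Finset.mem_insert_self _ _) (Finset.mem_insert_self _ _)⟩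
    · rintro x hx y hy hxy
      obtain ⟨hJa, haQ, -, -⟩ := hmem x hx
      obtain ⟨hJa', haQ', -, -⟩ := hmem y hy
      -- the pair inserted into `x.2` is the only one whose subset contains `a`
      have hp : (insert a x.1.2, x.1.1) = (insert a y.1.2, y.1.1) := by
        have := Finset.mem_insert_self (insert a x.1.2, x.1.1) x.2
        rw [hxy] at this
        exact (Finset.mem_insert.1 this).resolve_right
          fun h' => haQ' _ h' (Finset.mem_insert_self _ _)
      have h1 : x.1 = y.1 := by
        refine Prod.ext (congrArg Prod.snd hp) ?_
        have := congrArg nonMin (congrArg Prod.fst hp)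
        rwa [nonMin_insert hJa, nonMin_insert hJa'] at this
      have h2 : x.2 = y.2 := by
        have := congrArg (fun P => Finset.erase P (insert a x.1.2, x.1.1)) hxy
        rwa [Finset.erase_insert fun h' => haQ _ h' (Finset.mem_insert_self _ _), hp,
          Finset.erase_insert fun h' => haQ' _ h' (Finset.mem_insert_self _ _)] at this
      exact Sigma.ext h1 (heq_of_eq h2)
    · intro P hP
      rw [Finset.mem_filter, mem_decoratedExtractions] at hP
      obtain ⟨⟨h1, h2, h3⟩, h4⟩ := hP
      push Not at h4
      obtain ⟨p, hp, hap⟩ := h4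
      refine ⟨⟨(p.2, p.1.erase a), P.erase p⟩, ?_, ?_⟩
      · rw [Finset.mem_sigma, Finset.mem_product, Finset.mem_powerset, mem_decoratedExtractions]
        refine ⟨⟨Finset.mem_univ _, Finset.subset_insert_iff.1 (h1 p hp)⟩, fun q hq v hv => ?_,
          fun q hq => h2 q (Finset.mem_of_mem_erase hq), fun q hq r hr =>
          h3 q (Finset.mem_of_mem_erase hq) r (Finset.mem_of_mem_erase hr)⟩
        obtain ⟨hqp, hq⟩ := Finset.mem_erase.1 hq
        have hvp : v ∉ p.1 := Finset.disjoint_left.1 (h3 q hq p hp hqp) hv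
        have hva : v ≠ a := fun h' => hvp (h' ▸ hap)
        exact Finset.mem_sdiff.2 ⟨Finset.mem_of_mem_insert_of_ne (h1 q hq hv) hva,
          fun h' => hvp (Finset.mem_of_mem_erase h')⟩
      · dsimp only
        rw [Finset.insert_erase hap, Finset.insert_erase hp]
  · refine Finset.sum_eq_zero fun P hP => ?_
    exfalso
    rw [Finset.mem_filter, mem_decoratedExtractions] at hP
    obtain ⟨⟨h1, h2, -⟩, h4⟩ := hP
    refine h4 fun p hp hap => ?_
    obtain ⟨v, hv, hdv⟩ := h2 p hp
    rcases Finset.mem_insert.1 (h1 p hp hv.1) with rfl | hvs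
    · exact hd hdv
    · exact absurd (hv.2 hap) (not_le.2 (h v hvs))

/-- The sum over the extractions satisfies the recursion that defines `tildeWord`. -/
theorem sum_extractionTerm (i : Fin m) (s : Finset α) (d : α → Fin (m + 1)) :
    ∑ P ∈ decoratedExtractions s d, extractionTerm i s d P = tildeWord i (readWord s d) := by
  classical
  induction hN : s.card using Nat.strong_induction_on generalizing s with
  | _ N ih =>
    subst hN
    rcases s.eq_empty_or_nonempty with rfl | hs
    · have : decoratedExtractions (m := m) ∅ d = {∅} := by
        ext P
        rw [mem_decoratedExtractions, Finset.mem_singleton]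
        constructor
        · rintro ⟨h1, h2, -⟩
          refine Finset.eq_empty_of_forall_notMem fun p hp => ?_
          obtain ⟨v, hv, -⟩ := h2 p hp
          exact Finset.notMem_empty v (h1 p hp hv.1)
        · rintro rfl
          simp
      rw [this, Finset.sum_singleton, readWord_empty, tildeWord_nil, extractionTerm]
      simp [remaining, readWord_empty]
    · obtain ⟨a, t, h, rfl⟩ : ∃ a t, (∀ x ∈ t, a < x) ∧ insert a t = s :=
        ⟨s.min' hs, s.erase (s.min' hs), fun x hx => s.min'_lt_of_mem_erase_min' hs hx,
          Finset.insert_erase (s.min'_mem hs)⟩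
      have ha : a ∉ t := fun ha => lt_irrefl a (h a ha)
      have hcard : t.card < (insert a t).card := by simp [ha]
      rw [sum_decoratedExtractions_insert h, readWord_insert h, tildeWord_cons]
      congr 1
      · rw [Finset.sum_congr rfl fun P hP => extractionTerm_insert i h d hP, ← map_sum,
          ih _ hcard _ rfl]
      · split_ifs with hd
        swap
        · rfl
        refine Finset.sum_congr rfl fun n _ => ?_
        rw [sum_deshuffle_readWord]
        refine Finset.sum_congr rfl fun J hJ => ?_
        rw [Finset.mem_powerset] at hJ
        rw [← ih _ ((Finset.card_le_card Finset.sdiff_subset).trans_lt hcard) _ rfl, map_sum]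
        refine Finset.sum_congr rfl fun Q hQ => ?_
        exact extractionTerm_insert_insert i h hd hJ n hQ

end Extractions

/-! ### Trees as labels of coordinate maps -/

section Trees

variable {m : ℕ}

namespace Rct

/-- The tree with root `i` and word of decorations `η` corresponds to the coordinate map
`a^i_η`. -/
def toCoord (c : Rct m) : Coord m := ⟨c.root, c.word⟩

theorem toCoord_bijective : Function.Bijective (toCoord : Rct m → Coord m) := by
  constructor
  · rintro ⟨i, N, d⟩ ⟨i', N', d'⟩ h
    simp only [toCoord, word, Coord.mk.injEq] at h
    obtain ⟨rfl, h⟩ := h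
    rw [List.ofFn_inj'] at h
    cases h
    rfl
  · rintro ⟨i, w⟩
    exact ⟨⟨i, w.length, w.get⟩, by simp [toCoord, word]⟩

/-- Trees up to isomorphism correspond to coordinate maps. -/
def coordEquiv (m : ℕ) : Rct m ≃ Coord m := Equiv.ofBijective toCoord toCoord_bijective

theorem coordEquiv_apply (c : Rct m) : coordEquiv m c = ⟨c.root, c.word⟩ := rfl

theorem coordEquiv_bare (i : Fin m) : coordEquiv m (bare i) = ⟨i, []⟩ := by
  simp [coordEquiv_apply, bare, word]

theorem degree_coordEquiv (c : Rct m) : (coordEquiv m c).degree = c.degree := by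
  obtain ⟨i, N, d⟩ := c
  simp only [coordEquiv_apply, Coord.degree, degree, word]
  congr 1
  induction N with
  | zero => simp
  | succ N ih =>
    rw [List.ofFn_succ, Fin.sum_univ_succ, ← ih]
    simp only [List.count_cons, Finset.sum_add_distrib, mul_add]
    have hc : (∑ j : Fin m, if d 0 == j.succ then 1 else 0) + 2 * (if d 0 == 0 then 1 else 0) =
        if d 0 = 0 then 2 else 1 := by
      refine Fin.cases ?_ (fun n => ?_) (d 0)
      · simp [(Fin.succ_ne_zero _).symm]
      · simp
    rw [← hc]
    ring

theorem word_restrict (c : Rct m) (i : Fin m) (s : Finset (Fin c.size))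
    (d : Fin c.size → Fin (m + 1)) : (c.restrict i s d).word = readWord s d := by
  rw [word, restrict, readWord, ← Finset.listMap_orderEmbOfFin_finRange s rfl, List.map_map,
    List.ofFn_eq_map]
  rfl

theorem word_eq_readWord (c : Rct m) : c.word = readWord Finset.univ c.dec := by
  rw [word, readWord, Fin.sort_univ, List.ofFn_eq_map]

theorem word_insert (k : Fin (m + 1)) (c : Rct m) : (insert k c).word = k :: c.word := by
  rw [word, insert, List.ofFn_succ]
  rfl

theorem tail_eq_nonMin (c : Rct m) (J : Finset (Fin c.size)) : c.tail J = nonMin J := by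
  classical
  ext v
  rw [tail, Finset.mem_filter, mem_nonMin]

theorem mem_extractions {c : Rct m} {E : Finset (Finset (Fin c.size))} :
    E ∈ c.extractions ↔ (∀ J ∈ E, c.IsAdmissible J) ∧
      (E : Set (Finset (Fin c.size))).PairwiseDisjoint id := by
  classical
  rw [extractions, Finset.mem_filter, and_iff_right (Finset.mem_univ E)]

/-- The graph of a function on a finite set. -/
def graph {β γ : Type*} (E : Finset β) (n : E → γ) : Finset (β × γ) :=
  Finset.univ.map ⟨fun J : E => (J.1, n J), fun _ _ h => Subtype.ext (congrArg Prod.fst h)⟩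

theorem mem_graph {β γ : Type*} {E : Finset β} {n : E → γ} {p : β × γ} :
    p ∈ graph E n ↔ ∃ J : E, (J.1, n J) = p := by
  rw [graph, Finset.mem_map]
  simp only [Finset.mem_univ, true_and]
  rfl

theorem mk_mem_graph {β γ : Type*} {E : Finset β} (n : E → γ) (J : E) :
    (J.1, n J) ∈ graph E n := mem_graph.2 ⟨J, rfl⟩

theorem subset_of_graph_eq {β γ : Type*} {E E' : Finset β} {n : E → γ} {n' : E' → γ}
    (h : graph E n = graph E' n') : E ⊆ E' := fun J hJ => by
  have hJ' := mk_mem_graph n ⟨J, hJ⟩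
  rw [h] at hJ'
  obtain ⟨K, hK⟩ := mem_graph.1 hJ'
  have hKJ : K.1 = J := congrArg Prod.fst hK
  exact hKJ ▸ K.2

theorem graph_mem_decoratedExtractions {c : Rct m} {E : Finset (Finset (Fin c.size))}
    (hE : E ∈ c.extractions) (n : E → Fin m) :
    graph E n ∈ decoratedExtractions Finset.univ c.dec := by
  obtain ⟨h1, h2⟩ := mem_extractions.1 hE
  rw [mem_decoratedExtractions]
  refine ⟨fun _ _ => Finset.subset_univ _, ?_, ?_⟩
  · intro p hp
    obtain ⟨J, rfl⟩ := mem_graph.1 hp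
    exact h1 J.1 J.2
  · intro p hp q hq hpq
    obtain ⟨J, rfl⟩ := mem_graph.1 hp
    obtain ⟨K, rfl⟩ := mem_graph.1 hq
    exact h2 J.2 K.2 fun h => hpq (by rw [Subtype.ext h])

theorem extractionTerm_graph {c : Rct m} {E : Finset (Finset (Fin c.size))}
    (hE : E ∈ c.extractions) (n : E → Fin m) :
    extractionTerm c.root Finset.univ c.dec (graph E n) =
      Finsupp.single (coordEquiv m (c.quot E n)) (1 : ℝ) ⊗ₜ[ℝ]
        ∏ J : E, (MvPolynomial.X (coordEquiv m (c.sub J (n J))) : CoordAlgebra m) := by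
  have hP := (mem_decoratedExtractions.1 (graph_mem_decoratedExtractions hE n)).2.2
  rw [extractionTerm, coordEquiv_apply, quot, word_restrict]
  refine congrArg₂ (fun w y => Finsupp.single (⟨c.root, w⟩ : Coord m) (1 : ℝ) ⊗ₜ[ℝ] y)
    (readWord_congr ?_ fun v _ => ?_) ?_
  · ext v
    simp only [remaining, Finset.mem_filter, Finset.mem_univ, true_and, tail_eq_nonMin]
    refine ⟨fun h J hJ => h _ (mk_mem_graph n ⟨J, hJ⟩), fun h p hp => ?_⟩
    obtain ⟨J, rfl⟩ := mem_graph.1 hp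
    exact h J.1 J.2
  · split_ifs with h
    · exact redecorate_of_isLeast c.dec hP (mk_mem_graph n h.choose) h.choose_spec
    · refine redecorate_of_forall_not c.dec fun p hp hv => h ?_
      obtain ⟨J, rfl⟩ := mem_graph.1 hp
      exact ⟨J, hv⟩
  · rw [graph, Finset.prod_map]
    refine Finset.prod_congr rfl fun J _ => ?_
    rw [coordEquiv_apply, sub, word_restrict, tail_eq_nonMin]
    rfl

/-- An extraction with a choice of indices is the same as a decorated extraction. -/
theorem sum_extractions {M : Type*} [AddCommMonoid M] (c : Rct m)
    (f : Finset (Finset (Fin c.size) × Fin m) → M) :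
    ∑ E ∈ c.extractions, ∑ n : E → Fin m, f (graph E n) =
      ∑ P ∈ decoratedExtractions Finset.univ c.dec, f P := by
  classical
  rw [Finset.sum_sigma']
  refine Finset.sum_bij (fun x _ => graph x.1 x.2) ?_ ?_ ?_ fun _ _ => rfl
  · intro x hx
    exact graph_mem_decoratedExtractions (Finset.mem_sigma.1 hx).1 x.2
  · rintro ⟨E, n⟩ - ⟨E', n'⟩ - h
    dsimp only at h
    obtain rfl : E = E' := (subset_of_graph_eq h).antisymm (subset_of_graph_eq h.symm)
    congr 1
    funext J
    have hJ := mk_mem_graph n J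
    rw [h] at hJ
    obtain ⟨K, hK⟩ := mem_graph.1 hJ
    obtain rfl : K = J := Subtype.ext (congrArg Prod.fst hK)
    exact (congrArg Prod.snd hK).symm
  · intro P hP
    obtain ⟨-, h2, h3⟩ := mem_decoratedExtractions.1 hP
    have hex (J : P.image Prod.fst) : ∃ p ∈ P, p.1 = J.1 := Finset.mem_image.1 J.2
    -- a member of the extraction is nonempty, hence carries only one index
    have huniq : ∀ p ∈ P, ∀ q ∈ P, p.1 = q.1 → p = q := by
      intro p hp q hq hpq
      by_contra hne
      obtain ⟨v, hv, -⟩ := h2 p hp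
      exact Finset.disjoint_left.1 (h3 p hp q hq hne) hv.1 (hpq ▸ hv.1)
    refine ⟨⟨P.image Prod.fst, fun J => (hex J).choose.2⟩, ?_, ?_⟩
    · refine Finset.mem_sigma.2 ⟨mem_extractions.2 ⟨?_, ?_⟩,
        Finset.mem_univ _⟩
      · intro J hJ
        obtain ⟨p, hp, rfl⟩ := Finset.mem_image.1 hJ
        exact h2 p hp
      · intro J hJ K hK hJK
        obtain ⟨p, hp, rfl⟩ := Finset.mem_image.1 hJ
        obtain ⟨q, hq, rfl⟩ := Finset.mem_image.1 hK
        exact h3 p hp q hq fun h => hJK (by rw [h])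
    · ext p
      rw [mem_graph]
      constructor
      · rintro ⟨J, rfl⟩
        obtain ⟨hp, hJ⟩ := (hex J).choose_spec
        rw [← hJ]
        exact hp
      · intro hp
        refine ⟨⟨p.1, Finset.mem_image_of_mem _ hp⟩, ?_⟩
        obtain ⟨hp', hJ⟩ := (hex ⟨p.1, Finset.mem_image_of_mem _ hp⟩).choose_spec
        have hpp := huniq _ hp' _ hp hJ
        exact Prod.ext rfl (congrArg Prod.snd hpp :)

end Rct

/-- The isomorphism of the spans of trees and of coordinate maps. -/
def spanEquiv (m : ℕ) : RctSpan m ≃ₗ[ℝ] CoordSpan m := Finsupp.domLCongr (Rct.coordEquiv m)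

theorem spanEquiv_single (c : Rct m) (r : ℝ) :
    spanEquiv m (Finsupp.single c r) = Finsupp.single (Rct.coordEquiv m c) r :=
  Finsupp.domLCongr_single _ _ _

/-- The isomorphism of the polynomial algebras on trees and on coordinate maps. -/
def rctAlgEquiv (m : ℕ) : RctAlgebra m ≃ₐ[ℝ] CoordAlgebra m :=
  MvPolynomial.renameEquiv ℝ (Rct.coordEquiv m)

theorem rctAlgEquiv_X (c : Rct m) :
    rctAlgEquiv m (MvPolynomial.X c) = MvPolynomial.X (Rct.coordEquiv m c) := by
  simp [rctAlgEquiv]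

theorem rctTilde_single (c : Rct m) : rctTilde (Finsupp.single c 1) =
    ∑ E ∈ c.extractions, ∑ n : E → Fin m, Finsupp.single (c.quot E n) (1 : ℝ) ⊗ₜ[ℝ]
      ∏ J : E, (MvPolynomial.X (c.sub J (n J)) : RctAlgebra m) := by
  rw [rctTilde, Finsupp.linearCombination_single, one_smul]

/-- The extraction coproduct of trees is the coproduct `Δ̃` of the coordinate maps. -/
theorem map_rctTilde (x : RctSpan m) :
    TensorProduct.map (spanEquiv m).toLinearMap (rctAlgEquiv m).toLinearMap (rctTilde x) =
      coordTilde (spanEquiv m x) := by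
  induction x using Finsupp.induction_linear with
  | zero => simp
  | add x y hx hy => simp only [map_add, hx, hy]
  | single c r =>
    rw [← mul_one r, ← smul_eq_mul, ← Finsupp.smul_single]
    simp only [map_smul]
    congr 1
    rw [spanEquiv_single, coordTilde_single, Rct.coordEquiv_apply, Rct.word_eq_readWord,
      ← sum_extractionTerm, ← Rct.sum_extractions, rctTilde_single, map_sum]
    refine Finset.sum_congr rfl fun E hE => ?_
    rw [map_sum]
    refine Finset.sum_congr rfl fun n _ => ?_
    rw [Rct.extractionTerm_graph hE, TensorProduct.map_tmul]
    simp [spanEquiv_single, rctAlgEquiv_X, map_prod]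

/-- The deshuffling of trees is the deshuffling of words. -/
theorem map_rctDeshuffle (j : Fin m) (x : RctSpan m) :
    TensorProduct.map (spanEquiv m).toLinearMap (spanEquiv m).toLinearMap (rctDeshuffle j x) =
      coordDeshuffle j (spanEquiv m x) := by
  induction x using Finsupp.induction_linear with
  | zero => simp
  | add x y hx hy => simp only [map_add, hx, hy]
  | single c r =>
    rw [rctDeshuffle, spanEquiv_single, coordDeshuffle, Finsupp.linearCombination_single,
      Finsupp.linearCombination_single, map_smul, map_sum]
    congr 1
    rw [Rct.coordEquiv_apply, Rct.word_eq_readWord, sum_deshuffle_readWord, Finset.powerset_univ]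
    refine Finset.sum_congr rfl fun J _ => ?_
    rw [TensorProduct.map_tmul, LinearEquiv.coe_coe, spanEquiv_single, spanEquiv_single,
      Rct.coordEquiv_apply, Rct.coordEquiv_apply, Rct.word_restrict, Rct.word_restrict,
      Finset.compl_eq_univ_sdiff]
    rfl

theorem spanEquiv_rctTheta (k : Fin (m + 1)) (x : RctSpan m) :
    spanEquiv m (rctTheta k x) = theta k (spanEquiv m x) := by
  induction x using Finsupp.induction_linear with
  | zero => simp
  | add x y hx hy => simp only [map_add, hx, hy]
  | single c r =>
    rw [rctTheta, Finsupp.lmapDomain_apply, Finsupp.mapDomain_single, spanEquiv_single,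
      spanEquiv_single, theta_single, Rct.coordEquiv_apply, Rct.word_insert]
    rfl

theorem rctAlgEquiv_incl (x : RctSpan m) :
    rctAlgEquiv m (incl (Rct m) x) = incl (Coord m) (spanEquiv m x) := by
  induction x using Finsupp.induction_linear with
  | zero => simp
  | add x y hx hy => simp only [map_add, hx, hy]
  | single c r => rw [spanEquiv_single, incl_single, incl_single, map_smul, rctAlgEquiv_X]

/-! ### The recursions -/

/-- The recursions of the coproduct of coordinate maps. -/
theorem coord_satisfiesRecursions :
    SatisfiesRecursions (m := m) (fun i => (⟨i, []⟩ : Coord m)) theta coordDeshuffle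
      coordTilde where
  dsh_empty i j := by
    rw [coordDeshuffle, Finsupp.linearCombination_single, one_smul]
    simp [deshuffle]
  dsh_theta j k := by
    refine Finsupp.lhom_ext' fun a => LinearMap.ext_ring ?_
    simp only [LinearMap.comp_apply, Finsupp.lsingle_apply, theta_single, coordDeshuffle,
      Finsupp.linearCombination_single, one_smul, map_list_sum, List.map_map]
    rw [deshuffle, List.map_append, List.sum_append, List.map_map, List.map_map,
      ← List.sum_map_add]
    congr 2
    funext p
    simp [theta_single]
  tilde_empty i := by rw [coordTilde_single, tildeWord_nil]
  tilde_theta i := by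
    refine Finsupp.lhom_ext' fun a => LinearMap.ext_ring ?_
    simp only [LinearMap.comp_apply, Finsupp.lsingle_apply, theta_single, coordTilde_single]
    rw [tildeWord_cons, if_neg (Fin.succ_ne_zero i), add_zero]
  tilde_theta_zero := by
    refine Finsupp.lhom_ext' fun a => LinearMap.ext_ring ?_
    simp only [LinearMap.comp_apply, Finsupp.lsingle_apply, theta_single, coordTilde_single,
      LinearMap.add_apply, LinearMap.sum_apply]
    rw [tildeWord_cons, if_pos rfl]
    congr 1
    refine Finset.sum_congr rfl fun n _ => ?_
    rw [coordDeshuffle, Finsupp.linearCombination_single, one_smul]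
    simp only [map_list_sum, List.map_map]
    congr 1
    refine List.map_congr_left fun p _ => ?_
    simp only [Function.comp_apply, LinearMap.rTensor_tmul, coordTilde_single]
    generalize tildeWord a.idx p.1 = t
    induction t with
    | zero => simp
    | add x y hx hy => simp only [map_add, TensorProduct.add_tmul, hx, hy]
    | tmul x y => simp [incl_single]

/-- A map of tensor products induced by two isomorphisms is injective. -/
theorem map_equiv_injective {M M' N N' : Type*} [AddCommGroup M] [AddCommGroup M']
    [AddCommGroup N] [AddCommGroup N'] [Module ℝ M] [Module ℝ M'] [Module ℝ N] [Module ℝ N']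
    (f : M ≃ₗ[ℝ] M') (g : N ≃ₗ[ℝ] N') :
    Function.Injective (TensorProduct.map f.toLinearMap g.toLinearMap) :=
  (TensorProduct.congr f g).injective

/-- The recursions of the coproduct of trees, transported from those of the coordinate maps. -/
theorem rct_satisfiesRecursions :
    SatisfiesRecursions (m := m) Rct.bare rctTheta rctDeshuffle rctTilde where
  dsh_empty i j := by
    refine map_equiv_injective (spanEquiv m) (spanEquiv m) ?_
    rw [map_rctDeshuffle, spanEquiv_single]
    simpa [spanEquiv_single, Rct.coordEquiv_bare] using coord_satisfiesRecursions.dsh_empty i j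
  dsh_theta j k := by
    refine LinearMap.ext fun x => map_equiv_injective (spanEquiv m) (spanEquiv m) ?_
    have h := LinearMap.congr_fun (coord_satisfiesRecursions.dsh_theta j k) (spanEquiv m x)
    simp only [LinearMap.comp_apply] at h ⊢
    rw [map_rctDeshuffle, spanEquiv_rctTheta, h, ← map_rctDeshuffle]
    generalize rctDeshuffle j x = t
    induction t with
    | zero => simp
    | add x y hx hy => simp only [map_add, hx, hy]
    | tmul x y => simp [spanEquiv_rctTheta]
  tilde_empty i := by
    refine map_equiv_injective (spanEquiv m) (rctAlgEquiv m).toLinearEquiv ?_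
    refine (map_rctTilde _).trans ?_
    rw [spanEquiv_single]
    simpa [spanEquiv_single, Rct.coordEquiv_bare] using coord_satisfiesRecursions.tilde_empty i
  tilde_theta i := by
    refine LinearMap.ext fun x =>
      map_equiv_injective (spanEquiv m) (rctAlgEquiv m).toLinearEquiv ?_
    refine (map_rctTilde _).trans ?_
    have h := LinearMap.congr_fun (coord_satisfiesRecursions.tilde_theta i) (spanEquiv m x)
    simp only [LinearMap.comp_apply] at h ⊢
    rw [spanEquiv_rctTheta, h, ← map_rctTilde]
    generalize rctTilde x = t
    induction t with
    | zero => simp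
    | add x y hx hy => simp only [map_add, hx, hy]
    | tmul x y => simp [spanEquiv_rctTheta]
  tilde_theta_zero := by
    refine LinearMap.ext fun x =>
      map_equiv_injective (spanEquiv m) (rctAlgEquiv m).toLinearEquiv ?_
    refine (map_rctTilde _).trans ?_
    have h := LinearMap.congr_fun coord_satisfiesRecursions.tilde_theta_zero (spanEquiv m x)
    simp only [LinearMap.comp_apply, LinearMap.add_apply, LinearMap.sum_apply] at h ⊢
    rw [spanEquiv_rctTheta, h, ← map_rctTilde, map_add, map_sum]
    congr 1
    · generalize rctTilde x = t
      induction t with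
      | zero => simp
      | add x y hx hy => simp only [map_add, hx, hy]
      | tmul x y => simp [spanEquiv_rctTheta]
    · refine Finset.sum_congr rfl fun n _ => ?_
      rw [← map_rctDeshuffle]
      generalize rctDeshuffle n x = t
      induction t with
      | zero => simp
      | add x y hx hy => simp only [map_add, hx, hy]
      | tmul x y =>
        simp only [TensorProduct.map_tmul, LinearMap.rTensor_tmul, LinearEquiv.coe_coe,
          ← map_rctTilde]
        generalize rctTilde x = t
        induction t with
        | zero => simp
        | add x y hx hy => simp only [map_add, TensorProduct.add_tmul, hx, hy]
        | tmul z y => simp [spanEquiv_rctTheta, rctAlgEquiv_incl]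

end Trees

/-! ### Transport of the Hopf algebra structure -/

section Transport

variable {A B : Type*} [CommRing A] [CommRing B] [Algebra ℝ A] [Algebra ℝ B]
  [CoalgebraStruct ℝ A] [CoalgebraStruct ℝ B]

/-- An algebra isomorphism that intertwines the structure maps carries the Hopf algebra axioms
over. -/
theorem IsHopfAlgebra.of_algEquiv {S : B →ₗ[ℝ] B} (h : IsHopfAlgebra B S) (φ : A ≃ₐ[ℝ] B)
    (hΔ : ∀ a : A, TensorProduct.map φ.toLinearMap φ.toLinearMap
      (CoalgebraStruct.comul (R := ℝ) a) = CoalgebraStruct.comul (R := ℝ) (φ a))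
    (hε : ∀ a : A, CoalgebraStruct.counit (R := ℝ) (φ a) = CoalgebraStruct.counit (R := ℝ) a) :
    IsHopfAlgebra A (φ.symm.toLinearMap ∘ₗ S ∘ₗ φ.toLinearMap) := by
  have hinj : Function.Injective (TensorProduct.map φ.toLinearMap φ.toLinearMap) :=
    map_equiv_injective φ.toLinearEquiv φ.toLinearEquiv
  have hmul (s t : A ⊗[ℝ] A) : TensorProduct.map φ.toLinearMap φ.toLinearMap (s * t) =
      TensorProduct.map φ.toLinearMap φ.toLinearMap s *
        TensorProduct.map φ.toLinearMap φ.toLinearMap t :=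
    map_mul (Algebra.TensorProduct.map φ.toAlgHom φ.toAlgHom) s t
  refine ⟨?_, ?_, ?_, ?_, ?_, ?_, ?_, ?_, ?_⟩
  · refine LinearMap.ext fun a => map_equiv_injective φ.toLinearEquiv
      (TensorProduct.congr φ.toLinearEquiv φ.toLinearEquiv) ?_
    change TensorProduct.map φ.toLinearMap (TensorProduct.map φ.toLinearMap φ.toLinearMap) _ =
      TensorProduct.map φ.toLinearMap (TensorProduct.map φ.toLinearMap φ.toLinearMap) _
    have h1 (t : A ⊗[ℝ] A) : TensorProduct.map φ.toLinearMap
        (TensorProduct.map φ.toLinearMap φ.toLinearMap) (TensorProduct.assoc ℝ A A A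
          ((CoalgebraStruct.comul (R := ℝ) (A := A)).rTensor A t)) =
        TensorProduct.assoc ℝ B B B ((CoalgebraStruct.comul (R := ℝ) (A := B)).rTensor B
          (TensorProduct.map φ.toLinearMap φ.toLinearMap t)) := by
      induction t with
      | zero => simp
      | add x y hx hy => simp only [map_add, hx, hy]
      | tmul x y =>
        simp only [TensorProduct.map_tmul, LinearMap.rTensor_tmul, AlgEquiv.toLinearMap_apply,
          ← hΔ]
        generalize CoalgebraStruct.comul (R := ℝ) x = u
        induction u with
        | zero => simp
        | add x y hx hy => simp only [map_add, TensorProduct.add_tmul, hx, hy]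
        | tmul x y => simp
    have h2 (t : A ⊗[ℝ] A) : TensorProduct.map φ.toLinearMap
        (TensorProduct.map φ.toLinearMap φ.toLinearMap)
          ((CoalgebraStruct.comul (R := ℝ) (A := A)).lTensor A t) =
        (CoalgebraStruct.comul (R := ℝ) (A := B)).lTensor B
          (TensorProduct.map φ.toLinearMap φ.toLinearMap t) := by
      induction t with
      | zero => simp
      | add x y hx hy => simp only [map_add, hx, hy]
      | tmul x y => simp [hΔ]
    have h3 := LinearMap.congr_fun h.coassoc (φ a)
    simp only [LinearMap.comp_apply, LinearEquiv.coe_coe] at h3 ⊢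
    rw [h1, h2, hΔ, h3]
  · refine LinearMap.ext fun a => map_equiv_injective (LinearEquiv.refl ℝ ℝ) φ.toLinearEquiv ?_
    have h1 (t : A ⊗[ℝ] A) : TensorProduct.map (LinearEquiv.refl ℝ ℝ).toLinearMap
        φ.toLinearEquiv.toLinearMap ((CoalgebraStruct.counit (R := ℝ) (A := A)).rTensor A t) =
        (CoalgebraStruct.counit (R := ℝ) (A := B)).rTensor B
          (TensorProduct.map φ.toLinearMap φ.toLinearMap t) := by
      induction t with
      | zero => simp
      | add x y hx hy => simp only [map_add, hx, hy]
      | tmul x y => simp [hε]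
    have h3 := LinearMap.congr_fun h.rTensor_counit_comp_comul (φ a)
    simp only [LinearMap.comp_apply] at h3 ⊢
    rw [h1, hΔ, h3]
    simp
  · refine LinearMap.ext fun a => map_equiv_injective φ.toLinearEquiv (LinearEquiv.refl ℝ ℝ) ?_
    have h1 (t : A ⊗[ℝ] A) : TensorProduct.map φ.toLinearEquiv.toLinearMap
        (LinearEquiv.refl ℝ ℝ).toLinearMap
          ((CoalgebraStruct.counit (R := ℝ) (A := A)).lTensor A t) =
        (CoalgebraStruct.counit (R := ℝ) (A := B)).lTensor B
          (TensorProduct.map φ.toLinearMap φ.toLinearMap t) := by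
      induction t with
      | zero => simp
      | add x y hx hy => simp only [map_add, hx, hy]
      | tmul x y => simp [hε]
    have h3 := LinearMap.congr_fun h.lTensor_counit_comp_comul (φ a)
    simp only [LinearMap.comp_apply] at h3 ⊢
    rw [h1, hΔ, h3]
    simp
  · rw [← hε, map_one, h.counit_one]
  · intro a b
    rw [← hε, map_mul, h.counit_mul, hε, hε]
  · apply hinj
    rw [hΔ, map_one, h.comul_one]
    simp [Algebra.TensorProduct.one_def]
  · intro a b
    apply hinj
    rw [hΔ, map_mul, h.comul_mul, hmul, hΔ, hΔ]
  · refine LinearMap.ext fun a => φ.injective ?_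
    have h1 (t : A ⊗[ℝ] A) : φ (LinearMap.mul' ℝ A
        ((φ.symm.toLinearMap ∘ₗ S ∘ₗ φ.toLinearMap).rTensor A t)) =
        LinearMap.mul' ℝ B (S.rTensor B (TensorProduct.map φ.toLinearMap φ.toLinearMap t)) := by
      induction t with
      | zero => simp
      | add x y hx hy => simp only [map_add, hx, hy]
      | tmul x y => simp
    have h3 := LinearMap.congr_fun h.antipode_left (φ a)
    simp only [LinearMap.comp_apply] at h3 ⊢
    refine (h1 _).trans ?_
    rw [hΔ, h3, hε]
    simp
  · refine LinearMap.ext fun a => φ.injective ?_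
    have h1 (t : A ⊗[ℝ] A) : φ (LinearMap.mul' ℝ A
        ((φ.symm.toLinearMap ∘ₗ S ∘ₗ φ.toLinearMap).lTensor A t)) =
        LinearMap.mul' ℝ B (S.lTensor B (TensorProduct.map φ.toLinearMap φ.toLinearMap t)) := by
      induction t with
      | zero => simp
      | add x y hx hy => simp only [map_add, hx, hy]
      | tmul x y => simp
    have h3 := LinearMap.congr_fun h.antipode_right (φ a)
    simp only [LinearMap.comp_apply] at h3 ⊢
    refine (h1 _).trans ?_
    rw [hΔ, h3, hε]
    simp

end Transport

/-! ### The isomorphism -/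

section Isomorphism

variable {m : ℕ}

/-- The coproduct of trees as an algebra homomorphism. -/
def rctComul (m : ℕ) : RctAlgebra m →ₐ[ℝ] RctAlgebra m ⊗[ℝ] RctAlgebra m :=
  MvPolynomial.aeval fun c : Rct m =>
    TensorProduct.map (incl (Rct m)) LinearMap.id (rctTilde (Finsupp.single c (1 : ℝ))) +
      (1 : RctAlgebra m) ⊗ₜ[ℝ] (MvPolynomial.X c : RctAlgebra m)

theorem rctAlgEquiv_comul (f : RctAlgebra m) :
    TensorProduct.map (rctAlgEquiv m).toLinearMap (rctAlgEquiv m).toLinearMap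
      (CoalgebraStruct.comul (R := ℝ) f) = CoalgebraStruct.comul (R := ℝ) (rctAlgEquiv m f) := by
  have h : (Algebra.TensorProduct.map (rctAlgEquiv m).toAlgHom (rctAlgEquiv m).toAlgHom).comp
      (rctComul m) = (coordComul m).comp (rctAlgEquiv m).toAlgHom := by
    refine MvPolynomial.algHom_ext fun c => ?_
    have h1 (t : RctSpan m ⊗[ℝ] RctAlgebra m) : Algebra.TensorProduct.map
        (rctAlgEquiv m).toAlgHom (rctAlgEquiv m).toAlgHom
          (TensorProduct.map (incl (Rct m)) LinearMap.id t) =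
        TensorProduct.map (incl (Coord m)) LinearMap.id
          (TensorProduct.map (spanEquiv m).toLinearMap (rctAlgEquiv m).toLinearMap t) := by
      induction t with
      | zero => simp
      | add x y hx hy => simp only [map_add, hx, hy]
      | tmul x y => simp [rctAlgEquiv_incl]
    have h2 : (rctAlgEquiv m).toAlgHom (MvPolynomial.X c) =
        MvPolynomial.X (Rct.coordEquiv m c) := rctAlgEquiv_X c
    rw [AlgHom.comp_apply, AlgHom.comp_apply, h2, rctComul, coordComul, MvPolynomial.aeval_X,
      MvPolynomial.aeval_X, map_add, h1, map_rctTilde, spanEquiv_single,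
      Algebra.TensorProduct.map_tmul, h2, map_one]
  exact AlgHom.congr_fun h f

theorem rctAlgEquiv_counit (f : RctAlgebra m) :
    CoalgebraStruct.counit (R := ℝ) (rctAlgEquiv m f) = CoalgebraStruct.counit (R := ℝ) f := by
  have h : (coordCounit m).comp (rctAlgEquiv m).toAlgHom = MvPolynomial.aeval fun _ => (0 : ℝ) := by
    refine MvPolynomial.algHom_ext fun c => ?_
    have h2 : (rctAlgEquiv m).toAlgHom (MvPolynomial.X c) =
        MvPolynomial.X (Rct.coordEquiv m c) := rctAlgEquiv_X c
    rw [AlgHom.comp_apply, h2, coordCounit, MvPolynomial.aeval_X, MvPolynomial.aeval_X]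
  exact AlgHom.congr_fun h f

/-- The bialgebra isomorphism that sends a tree with root `i` and word of decorations `η` to
`a^i_η`. Its fields are given one by one because the structure maps are those of trees and of
coordinate maps, not those that Mathlib puts on polynomials as a monoid algebra. -/
def rctBialgEquiv (m : ℕ) : RctAlgebra m ≃ₐc[ℝ] CoordAlgebra m where
  __ := rctAlgEquiv m
  map_smul' := map_smul (rctAlgEquiv m)
  counit_comp := LinearMap.ext rctAlgEquiv_counit
  map_comp_comul := LinearMap.ext rctAlgEquiv_comul

end Isomorphism

/-- Renaming the variables along a bijection that preserves their weights preserves weighted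
homogeneity. -/
theorem isWeightedHomogeneous_rename_equiv {σ τ : Type*} (e : σ ≃ τ) {w : σ → ℕ} {w' : τ → ℕ}
    (hw : ∀ a, w' (e a) = w a) (f : MvPolynomial σ ℝ) (n : ℕ) :
    MvPolynomial.IsWeightedHomogeneous w f n ↔
      MvPolynomial.IsWeightedHomogeneous w' (MvPolynomial.rename e f) n := by
  have hweight (u : σ →₀ ℕ) : Finsupp.weight w' (u.mapDomain e) = Finsupp.weight w u := by
    rw [Finsupp.weight_apply, Finsupp.weight_apply, Finsupp.sum_mapDomain_index (by simp)
      (by intros; exact add_smul _ _ _)]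
    simp only [hw]
  constructor
  · intro h d hd
    obtain ⟨u, rfl, hu⟩ := MvPolynomial.coeff_rename_ne_zero _ _ _ hd
    rw [hweight, h hu]
  · intro h u hu
    rw [← hweight]
    refine h ?_
    rwa [MvPolynomial.coeff_rename_mapDomain _ e.injective]

end

end RctHopf

theorem mainTheorem3 (m : ℕ) :
    -- both are Hopf algebras
    ∃ (S₁ : RctHopf.RctAlgebra m →ₗ[ℝ] RctHopf.RctAlgebra m)
      (S₂ : RctHopf.CoordAlgebra m →ₗ[ℝ] RctHopf.CoordAlgebra m),
      RctHopf.IsHopfAlgebra (RctHopf.RctAlgebra m) S₁ ∧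
      RctHopf.IsHopfAlgebra (RctHopf.CoordAlgebra m) S₂ ∧
      -- the coproduct of `H` is the one induced by the product of the output feedback group
      (∀ (f : RctHopf.CoordAlgebra m) (c d : Fin m → RctHopf.Series m),
        RctHopf.evalAtPair c d (CoalgebraStruct.comul (R := ℝ) f) =
          RctHopf.evalAt (RctHopf.feedbackProd c d) f) ∧
      -- the isomorphism of graded Hopf algebras
      (∃ φ : RctHopf.RctAlgebra m ≃ₐc[ℝ] RctHopf.CoordAlgebra m,
        (∀ c : RctHopf.Rct m,
          φ (MvPolynomial.X c) = MvPolynomial.X (⟨c.root, c.word⟩ : RctHopf.Coord m)) ∧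
        (∀ f, φ (S₁ f) = S₂ (φ f)) ∧
        (∀ (f : RctHopf.RctAlgebra m) (n : ℕ),
          MvPolynomial.IsWeightedHomogeneous RctHopf.Rct.degree f n ↔
            MvPolynomial.IsWeightedHomogeneous RctHopf.Coord.degree (φ f) n)) ∧
      -- the coproducts of trees and of coordinate maps satisfy the same recursions
      RctHopf.SatisfiesRecursions (m := m) RctHopf.Rct.bare RctHopf.rctTheta
        RctHopf.rctDeshuffle RctHopf.rctTilde ∧
      RctHopf.SatisfiesRecursions (m := m) (fun i => (⟨i, []⟩ : RctHopf.Coord m)) RctHopf.theta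
        RctHopf.coordDeshuffle RctHopf.coordTilde := by
  refine ⟨(RctHopf.rctAlgEquiv m).symm.toLinearMap ∘ₗ
      (RctHopf.coordAntipode m).toLinearMap ∘ₗ (RctHopf.rctAlgEquiv m).toLinearMap,
    (RctHopf.coordAntipode m).toLinearMap,
    RctHopf.coord_isHopfAlgebra.of_algEquiv (RctHopf.rctAlgEquiv m) RctHopf.rctAlgEquiv_comul
      RctHopf.rctAlgEquiv_counit,
    RctHopf.coord_isHopfAlgebra, RctHopf.comul_evalAtPair,
    ⟨RctHopf.rctBialgEquiv m, RctHopf.rctAlgEquiv_X, fun f => ?_, fun f n => ?_⟩,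
    RctHopf.rct_satisfiesRecursions, RctHopf.coord_satisfiesRecursions⟩
  · exact (RctHopf.rctAlgEquiv m).apply_symm_apply _
  · exact RctHopf.isWeightedHomogeneous_rename_equiv (RctHopf.Rct.coordEquiv m)
      RctHopf.Rct.degree_coordEquiv f n
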